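/- Graphs are finite and may have loops and multiple edges; metric graphs are given by a model $(G,\ell)$, $\ell:E(G)\to\mathbb{R}_{>0}$. A double cover $\pi:\widetilde\Gamma\to\Gamma$ of metric graphs is a harmonic morphism of global degree two (so $\ell(\pi(\tilde e))=d_\pi(\tilde e)\,\ell(\tilde e)$); an edge of $\Gamma$ is undilated if the local degree $d_\pi$ is $1$ on every edge above it. Write $\Gamma\backslash F$ for $\Gamma$ with the edges $F$ removed and all vertices kept. The signed cographic matroid $M^*(\widetilde\Gamma/\Gamma)$ has as ground set the undilated edges of $\Gamma$. A set $F$ of undilated edges is independent if the preimage of each connected component of $\Gamma\backslash F$ is connected in $\widetilde\Gamma\backslash\pi^{-1}(F)$. Circuits are the minimal dependent sets, and an $n$-circuit is a circuit with $n$ elements. For an edge $f$ put $\operatorname{mult}(f)=2^{\operatorname{ind}(\{f\})-\operatorname{ind}(\emptyset)}$, where $\operatorname{ind}(F)$ is the number of connected components of $\Gamma\backslash F$. Contracting a set $F$ of edges of $\Gamma$ in $\pi$ means contracting each connected component of the subgraph generated by $F$, and each connected component of its preimage, to a vertex; the local degree at a vertex of the new source is the degree of $\pi$ on the corresponding component.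 A simplification $\pi_{\mathrm{sim}}:\widetilde\Gamma_{\mathrm{sim}}\to\Gamma_{\mathrm{sim}}$ of $\pi$ is obtained as follows. First contract all edges that are $1$-circuits of $M^*(\widetilde\Gamma/\Gamma)$. Then, as long as the matroid of the current cover has a $2$-circuit, choose a $2$-circuit $\{f_1,f_2\}$ for which it is not the case that $\operatorname{mult}(f_1)=1$ and $\operatorname{mult}(f_2)=2$, contract $f_1$, and replace the length of $f_2$ by $$\ell(f_2)+\left(\frac{\operatorname{mult}(f_1)}{\operatorname{mult}(f_2)}\right)^2\ell(f_1).$$ (Thus the edge to be contracted may be chosen arbitrarily, except that in a $2$-circuit with multiplicities $1$ and $2$ the edge of multiplicity $2$ is contracted.) An integral torus is a triple $(\Lambda,\Lambda',[\cdot,\cdot])$ of two lattices of equal rank and a nondegenerate pairing $\Lambda\times\Lambda'\to\mathbb{R}$. A polarization is a homomorphism $\xi:\Lambda'\to\Lambda$ such that $[\xi(\cdot),\cdot]$ is symmetric and positive definite on $\Lambda'_{\mathbb R}$; it is principal if $\xi$ is bijective. The Jacobian of $\Gamma$ is $\operatorname{Jac}(\Gamma)=(\Omega^1_\Gamma,H_1(\Gamma,\mathbb{Z}),[\cdot,\cdot])$,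 where $\Omega^1_\Gamma=H_1(\Gamma,\mathbb{Z})$ and $[\omega,\gamma]=\sum_e\omega(e)\gamma(e)\ell(e)$, with the identity as principal polarization. The Prym variety $\operatorname{Prym}(\widetilde\Gamma/\Gamma)$ is the kernel torus $\big((\operatorname{Coker}\pi^*)^{\mathrm{tf}},\operatorname{Ker}\pi_*,[\cdot,\cdot]\big)$ of the norm homomorphism $(\pi^*,\pi_*):\operatorname{Jac}(\widetilde\Gamma)\to\operatorname{Jac}(\Gamma)$, where $A^{\mathrm{tf}}$ is the quotient of $A$ by its torsion, with the polarization $\xi$ induced from $\operatorname{Jac}(\widetilde\Gamma)$. Its principalization is $\operatorname{Prym}_p(\widetilde\Gamma/\Gamma)=\big(\operatorname{Im}\xi,\operatorname{Ker}\pi_*,[\cdot,\cdot]\big)$ with the principal polarization $\xi:\operatorname{Ker}\pi_*\to\operatorname{Im}\xi$. **Theorem.** Let $\pi:\widetilde\Gamma\to\Gamma$ be a double cover of metric graphs with $\widetilde\Gamma$ connected. Then $\pi$ has a simplification, and for every simplification $\pi_{\mathrm{sim}}:\widetilde\Gamma_{\mathrm{sim}}\to\Gamma_{\mathrm{sim}}$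 of $\pi$, $$\operatorname{Prym}_p(\widetilde\Gamma/\Gamma)\cong\operatorname{Prym}_p(\widetilde\Gamma_{\mathrm{sim}}/\Gamma_{\mathrm{sim}})$$ as principally polarized integral tori. -/

import Mathlib

open scoped TensorProduct

universe u

namespace TropicalPrym

section RealForms
variable {M N : Type u} [AddCommGroup M] [AddCommGroup N]

/-- The `ℝ`-bilinear extension to `N_ℝ = ℝ ⊗ N` of a `ℤ`-bilinear form on `N`. -/
noncomputable def realForm (B : N →ₗ[ℤ] N →ₗ[ℤ] ℝ) :
    (ℝ ⊗[ℤ] N) →ₗ[ℝ] (ℝ ⊗[ℤ] N) →ₗ[ℝ] ℝ :=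
  LinearMap.liftBaseChange ℝ
    ((LinearMap.liftBaseChangeEquiv ℝ).toLinearMap.restrictScalars ℤ ∘ₗ B)

theorem realForm_tmul (B : N →ₗ[ℤ] N →ₗ[ℤ] ℝ) (a b : ℝ) (x y : N) :
    realForm B (a ⊗ₜ x) (b ⊗ₜ y) = a * b * B x y := by
  simp [realForm, mul_assoc]

/-- A `ℤ`-bilinear real form on `N` whose extension to `N_ℝ` is symmetric and positive definite. -/
structure IsPosDef (B : N →ₗ[ℤ] N →ₗ[ℤ] ℝ) : Prop where
  symm : ∀ x y : ℝ ⊗[ℤ] N, realForm B x y = realForm B y x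
  pos : ∀ x : ℝ ⊗[ℤ] N, x ≠ 0 → 0 < realForm B x x

/-- For a pairing `M × N → ℝ`, the `ℝ`-linear extension `N_ℝ → Hom(M, ℝ)` of
`y ↦ [·, y]`. -/
noncomputable def realPeriod (P : M →ₗ[ℤ] N →ₗ[ℤ] ℝ) :
    (ℝ ⊗[ℤ] N) →ₗ[ℝ] (M →ₗ[ℤ] ℝ) :=
  LinearMap.liftBaseChange ℝ P.flip

theorem realPeriod_tmul (P : M →ₗ[ℤ] N →ₗ[ℤ] ℝ) (a : ℝ) (x : M) (y : N) :
    realPeriod P (a ⊗ₜ y) x = a * P x y := by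
  simp [realPeriod]

theorem realForm_eq_period (P : M →ₗ[ℤ] N →ₗ[ℤ] ℝ) (xi : N →ₗ[ℤ] M) (x y : ℝ ⊗[ℤ] N) :
    realForm (P ∘ₗ xi) x y = LinearMap.liftBaseChange ℝ (realPeriod P y ∘ₗ xi) x := by
  induction x with
  | zero => simp
  | add a b ha hb => simp [ha, hb]
  | tmul a m =>
    induction y with
    | zero => simp
    | add c d hc hd => simp [hc, hd, LinearMap.add_comp]
    | tmul b n => simp [realForm_tmul, realPeriod_tmul, mul_assoc]

theorem bijective_realPeriod [Module.Free ℤ M] [Module.Finite ℤ M] [Module.Free ℤ N]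
    [Module.Finite ℤ N] (P : M →ₗ[ℤ] N →ₗ[ℤ] ℝ) (xi : N ≃ₗ[ℤ] M)
    (h : IsPosDef (P ∘ₗ xi.toLinearMap)) : Function.Bijective (realPeriod P) := by
  have hinj : Function.Injective (realPeriod P) := by
    rw [← LinearMap.ker_eq_bot, LinearMap.ker_eq_bot']
    intro x hx
    by_contra hne
    have := h.pos x hne
    rw [realForm_eq_period, hx] at this
    simp at this
  have hr : Module.finrank ℝ (ℝ ⊗[ℤ] N) = Module.finrank ℝ (M →ₗ[ℤ] ℝ) := by
    rw [Module.finrank_baseChange, Module.finrank_linearMap, Module.finrank_self, mul_one,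
      xi.finrank_eq]
  exact ⟨hinj, (LinearMap.injective_iff_surjective_of_finrank_eq_finrank hr).1 hinj⟩

theorem IsPosDef.comap {B : M →ₗ[ℤ] M →ₗ[ℤ] ℝ} (h : IsPosDef B) (i : N →ₗ[ℤ] M)
    (hi : Function.Injective i) (C : N →ₗ[ℤ] N →ₗ[ℤ] ℝ) (hC : ∀ x y, C x y = B (i x) (i y)) :
    IsPosDef C := by
  have key : ∀ x y, realForm C x y
      = realForm B (i.baseChange ℝ x) (i.baseChange ℝ y) := by
    intro x y
    induction x with
    | zero => simp
    | add a b ha hb => simp [ha, hb]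
    | tmul a m =>
      induction y with
      | zero => simp
      | add c d hc hd => simp [hc, hd]
      | tmul b n => simp [realForm_tmul, hC]
  have hinj : Function.Injective (i.baseChange ℝ) :=
    Module.Flat.lTensor_preserves_injective_linearMap (M := ℝ) i hi
  refine ⟨fun x y => by rw [key, key, h.symm], fun x hx => ?_⟩
  rw [key]
  exact h.pos _ (fun h0 => hx (hinj (by simpa using h0)))

theorem isPosDef_sum {H : Type u} [Fintype H] (w : H → ℝ) (hw : ∀ h, 0 < w h)
    (B : (H → ℤ) →ₗ[ℤ] (H → ℤ) →ₗ[ℤ] ℝ)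
    (hB : ∀ x y, B x y = ∑ h, x h * y h * w h) : IsPosDef B := by
  classical
  have key : ∀ x y, realForm B x y = ∑ h, TensorProduct.piScalarRight ℤ ℝ ℝ H x h *
      TensorProduct.piScalarRight ℤ ℝ ℝ H y h * w h := by
    intro x y
    induction x with
    | zero => simp
    | add a b ha hb => simp [ha, hb, add_mul, Finset.sum_add_distrib]
    | tmul a m =>
      induction y with
      | zero => simp
      | add c d hc hd =>
        rw [map_add, hc, hd]; simp [mul_add, add_mul, Finset.sum_add_distrib]
      | tmul b n =>
        simp [realForm_tmul, hB, Finset.mul_sum]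
        refine Finset.sum_congr rfl fun h _ => by ring
  refine ⟨fun x y => by simp only [key, mul_comm], fun x hx => ?_⟩
  rw [key]
  have : ∃ h, TensorProduct.piScalarRight ℤ ℝ ℝ H x h ≠ 0 := by
    by_contra! hc
    exact hx ((TensorProduct.piScalarRight ℤ ℝ ℝ H).injective (by rw [map_zero]; exact funext hc))
  obtain ⟨h, hh⟩ := this
  refine Finset.sum_pos' (fun i _ => mul_nonneg (mul_self_nonneg _) (hw i).le) ⟨h, by simp, ?_⟩
  exact mul_pos (mul_self_pos.2 hh) (hw h)
end RealForms

/-! ### Integral tori and their polarizations -/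

/-- A real torus with integral structure `Σ = (Λ, Λ', [·,·])`: two lattices and a nondegenerate
pairing. Nondegeneracy says that `λ' ↦ [·, λ']` identifies `Λ'_ℝ` with `Hom(Λ, ℝ)`
(in particular the ranks agree), so that `Hom(Λ, ℝ) / Λ'` is a torus. -/
structure IntegralTorus : Type (u + 1) where
  L : Type u
  L' : Type u
  [grpL : AddCommGroup L]
  [grpL' : AddCommGroup L']
  [freeL : Module.Free ℤ L]
  [freeL' : Module.Free ℤ L']
  [finL : Module.Finite ℤ L]
  [finL' : Module.Finite ℤ L']
  pairing : L →ₗ[ℤ] L' →ₗ[ℤ] ℝ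
  nondeg : Function.Bijective (realPeriod pairing)

attribute [instance] IntegralTorus.grpL IntegralTorus.grpL' IntegralTorus.freeL
  IntegralTorus.freeL' IntegralTorus.finL IntegralTorus.finL'

/-- A homomorphism of integral tori `f = (f^#, f_#) : Σ₁ → Σ₂`. -/
structure TorusHom (S₁ S₂ : IntegralTorus.{u}) where
  up : S₂.L →ₗ[ℤ] S₁.L
  down : S₁.L' →ₗ[ℤ] S₂.L'
  adj : ∀ x y, S₁.pairing (up x) y = S₂.pairing x (down y)

/-- A polarization of an integral torus: a homomorphism `ξ : Λ' → Λ` such that the form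
`[ξ(·), ·]` on `Λ'_ℝ` is symmetric and positive definite. -/
structure Polarization (S : IntegralTorus.{u}) where
  xi : S.L' →ₗ[ℤ] S.L
  posDef : IsPosDef (S.pairing ∘ₗ xi)

theorem Polarization.injective {S : IntegralTorus.{u}} (p : Polarization S) :
    Function.Injective p.xi := by
  rw [← LinearMap.ker_eq_bot, LinearMap.ker_eq_bot']
  intro x hx
  by_contra hne
  have h1 : ((1 : ℝ) ⊗ₜ[ℤ] x) ≠ 0 := by
    intro h0
    refine hne ?_
    have hb := Module.Flat.rTensor_preserves_injective_linearMap (M := S.L')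
      (Algebra.linearMap ℤ ℝ) (fun a b h => by simpa using h)
    have : (LinearMap.rTensor S.L' (Algebra.linearMap ℤ ℝ)) ((1 : ℤ) ⊗ₜ x) = 0 := by
      simpa using h0
    have h2 := hb (this.trans (map_zero _).symm)
    simpa using congrArg (TensorProduct.lid ℤ S.L') h2
  have := p.posDef.pos _ h1
  simp [realForm_tmul, hx] at this

/-- A polarization is principal if it is bijective. -/
def Polarization.IsPrincipal {S : IntegralTorus.{u}} (p : Polarization S) : Prop :=
  Function.Bijective p.xi

/-- An integral torus with a polarization. -/
structure PolarizedTorus : Type (u + 1) where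
  torus : IntegralTorus.{u}
  pol : Polarization torus

/-- An isomorphism of polarized integral tori: an invertible homomorphism `(f^#, f_#)` of integral
tori for which the polarization induced from the target, `f^# ∘ ξ₂ ∘ f_#`, is that of the
source. -/
structure PolarizedTorus.Iso (A B : PolarizedTorus.{u}) where
  hom : TorusHom A.torus B.torus
  up_bij : Function.Bijective hom.up
  down_bij : Function.Bijective hom.down
  pol : ∀ x, hom.up (B.pol.xi (hom.down x)) = A.pol.xi x

section KernelTorus
variable {S₁ S₂ : IntegralTorus.{u}} (f : TorusHom S₁ S₂)

/-- The torsion-free quotient `(Coker f^#)^tf`. -/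
abbrev TorusHom.CokerTF : Type u :=
  (S₁.L ⧸ LinearMap.range f.up) ⧸ Submodule.torsion ℤ (S₁.L ⧸ LinearMap.range f.up)

/-- The quotient map `Λ₁ → (Coker f^#)^tf`. -/
def TorusHom.toCokerTF : S₁.L →ₗ[ℤ] f.CokerTF :=
  (Submodule.torsion ℤ _).mkQ ∘ₗ (LinearMap.range f.up).mkQ

theorem TorusHom.toCokerTF_surjective : Function.Surjective f.toCokerTF :=
  (Submodule.mkQ_surjective _).comp (Submodule.mkQ_surjective _)

/-- The pairing `(Coker f^#)^tf × Ker f_# → ℝ` induced by the pairing of the source. -/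
def TorusHom.kerPairing : f.CokerTF →ₗ[ℤ] LinearMap.ker f.down →ₗ[ℤ] ℝ :=
  Submodule.liftQ _
    (Submodule.liftQ _ ((LinearMap.lcomp ℤ ℝ (LinearMap.ker f.down).subtype) ∘ₗ S₁.pairing) (by
      rintro _ ⟨x, rfl⟩
      ext y
      simp [f.adj]))
    (by
      intro x hx
      obtain ⟨a, ha⟩ := (Submodule.mem_torsion_iff x).1 hx
      rw [LinearMap.mem_ker]
      have h2 := congrArg (Submodule.liftQ (LinearMap.range f.up)
        ((LinearMap.lcomp ℤ ℝ (LinearMap.ker f.down).subtype) ∘ₗ S₁.pairing) (by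
          rintro _ ⟨x, rfl⟩
          ext y
          simp [f.adj])) ha
      rw [map_zero] at h2
      have h3 : (a : ℤ) ≠ 0 := nonZeroDivisors.coe_ne_zero a
      have h4 := (map_zsmul _ (a : ℤ) x).symm.trans h2
      ext y
      have h5 := LinearMap.congr_fun h4 y
      simpa [h3] using h5)

theorem TorusHom.kerPairing_apply (x : S₁.L) (y : LinearMap.ker f.down) :
    f.kerPairing (f.toCokerTF x) y = S₁.pairing x y := rfl

theorem TorusHom.kerPairing_nondeg : Function.Bijective (realPeriod f.kerPairing) := by
  have key : ∀ (t : ℝ ⊗[ℤ] LinearMap.ker f.down) (x : S₁.L),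
      realPeriod f.kerPairing t (f.toCokerTF x) =
        realPeriod S₁.pairing ((LinearMap.ker f.down).subtype.baseChange ℝ t) x := by
    intro t x
    induction t with
    | zero => simp
    | add a b ha hb => simp [ha, hb]
    | tmul a y => simp [realPeriod_tmul, TorusHom.kerPairing_apply]
  have key2 : ∀ (t : ℝ ⊗[ℤ] S₁.L') (x : S₂.L),
      realPeriod S₂.pairing (f.down.baseChange ℝ t) x = realPeriod S₁.pairing t (f.up x) := by
    intro t x
    induction t with
    | zero => simp
    | add a b ha hb => simp [ha, hb]
    | tmul a y => simp [realPeriod_tmul, f.adj]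
  have hinj : Function.Injective ((LinearMap.ker f.down).subtype.baseChange ℝ) :=
    Module.Flat.lTensor_preserves_injective_linearMap (M := ℝ) _ (Submodule.subtype_injective _)
  constructor
  · rw [← LinearMap.ker_eq_bot, LinearMap.ker_eq_bot']
    intro t ht
    apply hinj
    apply S₁.nondeg.1
    ext x
    rw [← key, ht]
    simp
  · intro g
    obtain ⟨t, ht⟩ := S₁.nondeg.2 (g ∘ₗ f.toCokerTF)
    have hex := Module.Flat.lTensor_exact (M := ℝ)
      (LinearMap.exact_subtype_ker_map f.down)
    have h0 : f.down.baseChange ℝ t = 0 := by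
      apply S₂.nondeg.1
      ext x
      rw [key2, ht]
      have : f.toCokerTF (f.up x) = 0 := by
        have : (LinearMap.range f.up).mkQ (f.up x) = 0 := by simp
        simp only [TorusHom.toCokerTF, LinearMap.comp_apply, this, map_zero]
      simp [this]
    obtain ⟨s, hs⟩ := (hex t).1 h0
    refine ⟨s, LinearMap.ext fun z => ?_⟩
    obtain ⟨x, rfl⟩ := f.toCokerTF_surjective z
    rw [key]
    have : (LinearMap.ker f.down).subtype.baseChange ℝ s = t := hs
    rw [this, ht]
    rfl

/-- The kernel torus `(Ker f)_0 = ((Coker f^#)^tf, Ker f_#, [·,·]_K)`. -/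
def TorusHom.kernelTorus : IntegralTorus.{u} where
  L := f.CokerTF
  L' := LinearMap.ker f.down
  pairing := f.kerPairing
  nondeg := f.kerPairing_nondeg

/-- The natural injective homomorphism `(Ker f)_0 → Σ₁`. -/
def TorusHom.kernelIncl : TorusHom f.kernelTorus S₁ where
  up := f.toCokerTF
  down := (LinearMap.ker f.down).subtype
  adj := fun x y => f.kerPairing_apply x y

end KernelTorus

/-- The polarization `f^# ∘ ξ₂ ∘ f_#` induced along a finite homomorphism (one whose rank is the
dimension of its source, in other words with `f_#` injective). -/
def Polarization.induced {S₁ S₂ : IntegralTorus.{u}} (p : Polarization S₂) (f : TorusHom S₁ S₂)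
    (hf : Function.Injective f.down) : Polarization S₁ where
  xi := f.up ∘ₗ p.xi ∘ₗ f.down
  posDef := p.posDef.comap f.down hf _ (fun x y => by simp [f.adj])

/-- The principalization `(Im ξ, Λ', [·,·])` of a polarized integral torus, with the polarization
`ξ : Λ' → Im ξ`. -/
def PolarizedTorus.principalization (A : PolarizedTorus.{u}) : PolarizedTorus.{u} where
  torus :=
    { L := LinearMap.range A.pol.xi
      L' := A.torus.L'
      pairing := A.torus.pairing ∘ₗ (LinearMap.range A.pol.xi).subtype
      nondeg := bijective_realPeriod _ (LinearEquiv.ofInjective A.pol.xi A.pol.injective)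
        (A.pol.posDef.comap LinearMap.id Function.injective_id _ (fun _ _ => rfl)) }
  pol :=
    { xi := A.pol.xi.rangeRestrict
      posDef := A.pol.posDef.comap LinearMap.id Function.injective_id _ (fun _ _ => rfl) }

theorem PolarizedTorus.principalization_isPrincipal (A : PolarizedTorus.{u}) :
    A.principalization.pol.IsPrincipal :=
  ⟨fun _ _ h => A.pol.injective (congrArg Subtype.val h), A.pol.xi.surjective_rangeRestrict⟩

/-! ### Graphs, connectivity and contraction -/

/-- A finite graph, possibly with loops and multiple edges: vertices, half-edges, the root map,
and a fixed-point-free involution of the half-edges. -/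
structure Graph : Type (u + 1) where
  V : Type u
  H : Type u
  [fintypeV : Fintype V]
  [fintypeH : Fintype H]
  root : H → V
  inv : H → H
  inv_inv : ∀ h, inv (inv h) = h
  inv_ne : ∀ h, inv h ≠ h

attribute [instance] Graph.fintypeV Graph.fintypeH

namespace Graph
variable (G : Graph.{u})

/-- Two half-edges are equivalent if they form the same edge. -/
def edgeSetoid : Setoid G.H where
  r h k := k = h ∨ k = G.inv h
  iseqv :=
    { refl := fun _ => Or.inl rfl
      symm := by
        rintro h k (rfl | rfl)
        · exact Or.inl rfl
        · exact Or.inr (G.inv_inv h).symm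
      trans := by
        rintro h k l (rfl | rfl) (rfl | rfl)
        · exact Or.inl rfl
        · exact Or.inr rfl
        · exact Or.inr rfl
        · exact Or.inl (G.inv_inv h) }

/-- The edges of `G`: the orbits of the involution on half-edges. -/
def E : Type u := Quotient G.edgeSetoid

/-- The edge containing a half-edge. -/
def edge (h : G.H) : G.E := Quotient.mk G.edgeSetoid h

theorem edge_inv (h : G.H) : G.edge (G.inv h) = G.edge h :=
  Quotient.sound (s := G.edgeSetoid) (Or.inr (G.inv_inv h).symm)

theorem edge_surjective : Function.Surjective G.edge := Quotient.mk_surjective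

/-- `G.conn S v w` says that `v` and `w` can be joined by a path all of whose edges lie in `S`.
Its classes are the connected components of the graph with vertices `V(G)` and edges `S`. -/
def conn (S : Set G.E) : Setoid G.V :=
  Relation.EqvGen.setoid fun v w => ∃ h, G.edge h ∈ S ∧ G.root h = v ∧ G.root (G.inv h) = w

theorem conn_root {S : Set G.E} {h : G.H} (hh : G.edge h ∈ S) :
    G.conn S (G.root h) (G.root (G.inv h)) :=
  Relation.EqvGen.rel _ _ ⟨h, hh, rfl, rfl⟩

/-- `G` is connected (and nonempty). -/
def Connected : Prop := Nonempty G.V ∧ ∀ v w, G.conn Set.univ v w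

/-- The number of connected components of `G \ F`. -/
noncomputable def numComponents (F : Set G.E) : ℕ := Nat.card (Quotient (G.conn Fᶜ))

/-- The contraction `G_F`: each connected component of the subgraph generated by `F` becomes a
vertex, and the half-edges are those of the edges not in `F`. -/
noncomputable def contract (F : Set G.E) : Graph.{u} where
  V := Quotient (G.conn F)
  H := {h : G.H // G.edge h ∉ F}
  fintypeV := Fintype.ofFinite _
  fintypeH := Fintype.ofFinite _
  root h := Quotient.mk (G.conn F) (G.root h.1)
  inv h := ⟨G.inv h.1, by rw [G.edge_inv]; exact h.2⟩
  inv_inv h := Subtype.ext (G.inv_inv h.1)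
  inv_ne h := fun e => G.inv_ne h.1 (congrArg Subtype.val e)

/-- The edges of `G_F` are edges of `G`. -/
noncomputable def contractEdge (F : Set G.E) : (G.contract F).E → G.E :=
  Quotient.map' (s₁ := (G.contract F).edgeSetoid) (s₂ := G.edgeSetoid) Subtype.val (by
    rintro h k (e | e)
    · exact Or.inl (congrArg Subtype.val e)
    · exact Or.inr (congrArg Subtype.val e))

end Graph

/-- A metric graph, given by a model: a graph with positive edge lengths. -/
structure MetricGraph : Type (u + 1) extends Graph.{u} where
  len : toGraph.E → ℝ
  len_pos : ∀ e, 0 < len e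

/-- The contraction of a metric graph; the remaining edges keep their lengths. -/
noncomputable def MetricGraph.contract (G : MetricGraph.{u}) (F : Set G.E) : MetricGraph.{u} where
  toGraph := G.toGraph.contract F
  len e := G.len (G.contractEdge F e)
  len_pos _ := G.len_pos _

/-! ### Harmonic morphisms -/

open scoped Classical in
/-- A harmonic morphism of graphs: maps of vertices and half-edges commuting with the root and
involution maps, with positive local degrees that agree on the two halves of an edge and satisfy
the local balancing condition. -/
structure HarmonicMorphism (G' G : Graph.{u}) where
  onV : G'.V → G.V
  onH : G'.H → G.H
  map_root : ∀ h, G.root (onH h) = onV (G'.root h)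
  map_inv : ∀ h, onH (G'.inv h) = G.inv (onH h)
  degV : G'.V → ℕ
  degH : G'.H → ℕ
  degV_pos : ∀ v, 0 < degV v
  degH_pos : ∀ h, 0 < degH h
  degH_inv : ∀ h, degH (G'.inv h) = degH h
  balanced : ∀ (v : G'.V) (h : G.H), G.root h = onV v →
    degV v = ∑ k with G'.root k = v ∧ onH k = h, degH k

namespace HarmonicMorphism
variable {G' G : Graph.{u}} (f : HarmonicMorphism G' G)

/-- The induced map on edges. -/
def onE : G'.E → G.E :=
  Quotient.map' (s₁ := G'.edgeSetoid) (s₂ := G.edgeSetoid) f.onH (by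
    rintro h k (rfl | rfl)
    · exact Or.inl rfl
    · exact Or.inr (f.map_inv h))

theorem onE_edge (h : G'.H) : f.onE (G'.edge h) = G.edge (f.onH h) := rfl

/-- The local degree along an edge. -/
def degE : G'.E → ℕ :=
  Quotient.lift (s := G'.edgeSetoid) f.degH (by
    rintro h k (rfl | rfl)
    · rfl
    · exact (f.degH_inv h).symm)

theorem degE_edge (h : G'.H) : f.degE (G'.edge h) = f.degH h := rfl

theorem degE_pos (e : G'.E) : 0 < f.degE e := by
  obtain ⟨h, rfl⟩ := G'.edge_surjective e
  exact f.degH_pos h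

open scoped Classical in
/-- `f` has global degree `n`. -/
def HasDegree (n : ℕ) : Prop := ∀ v : G.V, ∑ w with f.onV w = v, f.degV w = n

theorem conn_map {F : Set G.E} {v w : G'.V} (h : G'.conn (f.onE ⁻¹' F) v w) :
    G.conn F (f.onV v) (f.onV w) := by
  induction h with
  | rel v w h =>
    obtain ⟨k, hk, rfl, rfl⟩ := h
    rw [← f.map_root, ← f.map_root, f.map_inv]
    exact G.conn_root hk
  | refl v => exact Setoid.refl' _ _
  | symm v w _ ih => exact Setoid.symm' _ ih
  | trans u v w _ _ ih1 ih2 => exact Setoid.trans' _ ih1 ih2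

open scoped Classical in
/-- The degree of `f` over the vertex `v`, on the connected component of `w₀` in the preimage of
the subgraph generated by `F`. -/
noncomputable def compDeg (F : Set G.E) (c : Quotient (G'.conn (f.onE ⁻¹' F))) (v : G.V) : ℕ :=
  ∑ w with Quotient.mk _ w = c ∧ f.onV w = v, f.degV w

open scoped Classical in
theorem compDeg_root (F : Set G.E) (c : Quotient (G'.conn (f.onE ⁻¹' F))) (h : G.H) :
    f.compDeg F c (G.root h) =
      ∑ k with Quotient.mk _ (G'.root k) = c ∧ f.onH k = h, f.degH k := by
  rw [compDeg]
  rw [Finset.sum_congr rfl (g := fun w => ∑ k with G'.root k = w ∧ f.onH k = h, f.degH k)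
    (fun w hw => f.balanced w h (Finset.mem_filter.1 hw).2.2.symm)]
  rw [Finset.sum_sigma']
  refine Finset.sum_bij (fun x _ => x.2) ?_ ?_ ?_ ?_
  · rintro ⟨w, k⟩ hx
    simp only [Finset.mem_sigma, Finset.mem_filter, Finset.mem_univ, true_and] at hx ⊢
    obtain ⟨⟨h1, h2⟩, h3, h4⟩ := hx
    exact ⟨by rw [h3]; exact h1, h4⟩
  · rintro ⟨w, k⟩ hx ⟨w', k'⟩ hx' e
    simp only [Finset.mem_sigma, Finset.mem_filter, Finset.mem_univ, true_and] at hx hx' e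
    subst e
    obtain ⟨_, h3, _⟩ := hx
    obtain ⟨_, h3', _⟩ := hx'
    subst h3
    subst h3'
    rfl
  · intro k hk
    simp only [Finset.mem_filter, Finset.mem_univ, true_and] at hk
    refine ⟨⟨G'.root k, k⟩, ?_, rfl⟩
    exact Finset.mem_sigma.2 ⟨Finset.mem_filter.2 ⟨Finset.mem_univ _, hk.1,
      by rw [← f.map_root, hk.2]⟩, Finset.mem_filter.2 ⟨Finset.mem_univ _, rfl, hk.2⟩⟩
  · intro _ _
    rfl

theorem compDeg_congr (F : Set G.E) (c : Quotient (G'.conn (f.onE ⁻¹' F))) {v w : G.V}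
    (h : G.conn F v w) : f.compDeg F c v = f.compDeg F c w := by
  classical
  induction h with
  | rel v w h =>
    obtain ⟨h, hh, rfl, rfl⟩ := h
    rw [compDeg_root, compDeg_root]
    have hc : ∀ k, f.onH k = h ∨ f.onH k = G.inv h →
        Quotient.mk (G'.conn (f.onE ⁻¹' F)) (G'.root (G'.inv k))
          = Quotient.mk _ (G'.root k) := by
      intro k hk
      refine Quotient.sound (Setoid.symm' _ (G'.conn_root ?_))
      rw [Set.mem_preimage, f.onE_edge]
      rcases hk with hk | hk <;> rw [hk]
      · exact hh
      · rw [G.edge_inv]; exact hh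
    refine Finset.sum_nbij' G'.inv G'.inv ?_ ?_ ?_ ?_ ?_
    · intro k hk
      simp only [Finset.mem_filter, Finset.mem_univ, true_and] at hk ⊢
      exact ⟨by rw [hc k (Or.inl hk.2)]; exact hk.1, by rw [f.map_inv, hk.2]⟩
    · intro k hk
      simp only [Finset.mem_filter, Finset.mem_univ, true_and] at hk ⊢
      exact ⟨by rw [hc k (Or.inr hk.2)]; exact hk.1, by rw [f.map_inv, hk.2, G.inv_inv]⟩
    · intro k _
      exact G'.inv_inv k
    · intro k _
      exact G'.inv_inv k
    · intro k _
      exact (f.degH_inv k).symm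
  | refl v => rfl
  | symm v w _ ih => exact ih.symm
  | trans u v w _ _ ih1 ih2 => exact ih1.trans ih2

/-- The contraction `f_F : G'_{f⁻¹(F)} → G_F` of a harmonic morphism. The local degree at the
vertex given by a connected component of the preimage of the contracted subgraph is the global
degree of `f` on that component (which may be computed over any vertex of its image). -/
noncomputable def contract (F : Set G.E) :
    HarmonicMorphism (G'.contract (f.onE ⁻¹' F)) (G.contract F) where
  onV := Quotient.map' f.onV fun _ _ h => f.conn_map h
  onH h := ⟨f.onH h.1, h.2⟩
  map_root h := congrArg (Quotient.mk (G.conn F)) (f.map_root h.1)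
  map_inv h := Subtype.ext (f.map_inv h.1)
  degV c := f.compDeg F c (f.onV (Quotient.out c))
  degH h := f.degH h.1
  degV_pos c := by
    classical
    refine Finset.sum_pos (fun w _ => f.degV_pos w) ⟨Quotient.out c, ?_⟩
    simp only [Finset.mem_filter, Finset.mem_univ, true_and, and_true]
    exact Quotient.out_eq c
  degH_pos h := f.degH_pos h.1
  degH_inv h := f.degH_inv h.1
  balanced c h hc := by
    classical
    obtain ⟨v, rfl⟩ : ∃ v, Quotient.mk (G'.conn (f.onE ⁻¹' F)) v = c := Quotient.exists_rep c
    have h1 : G.conn F (f.onV (Quotient.out (Quotient.mk (G'.conn (f.onE ⁻¹' F)) v)))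
        (G.root h.1) :=
      Setoid.trans' _ (f.conn_map (Quotient.mk_out v)) (Setoid.symm' _ (Quotient.exact hc))
    rw [f.compDeg_congr F _ h1, f.compDeg_root]
    symm
    refine Finset.sum_bij (fun k _ => k.1) ?_ ?_ ?_ ?_
    · intro k hk
      have hk2 := (Finset.mem_filter.1 hk).2
      exact Finset.mem_filter.2 ⟨Finset.mem_univ _, hk2.1, congrArg Subtype.val hk2.2⟩
    · intro k _ k' _ e
      exact Subtype.ext e
    · intro k hk
      simp only [Finset.mem_filter, Finset.mem_univ, true_and] at hk
      refine ⟨⟨k, ?_⟩, ?_, rfl⟩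
      · rw [Set.mem_preimage, f.onE_edge, hk.2]
        exact h.2
      · exact Finset.mem_filter.2 ⟨Finset.mem_univ _, hk.1, Subtype.ext hk.2⟩
    · intro _ _
      rfl

theorem contract_hasDegree (F : Set G.E) {n : ℕ} (h : f.HasDegree n) :
    (f.contract F).HasDegree n := by
  classical
  intro c
  obtain ⟨v, rfl⟩ : ∃ v, Quotient.mk (G.conn F) v = c := Quotient.exists_rep c
  have key : ∀ c' : Quotient (G'.conn (f.onE ⁻¹' F)),
      (f.contract F).onV c' = Quotient.mk (G.conn F) v →
        (f.contract F).degV c' = f.compDeg F c' v := by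
    intro c' hc'
    refine f.compDeg_congr F c' (Quotient.exact (s := G.conn F) ?_)
    rw [← hc']
    conv_rhs => rw [← Quotient.out_eq c']
    rfl
  refine (Finset.sum_congr rfl (fun c' hc' => key c' (Finset.mem_filter.1 hc').2)).trans ?_
  rw [← h v]
  simp only [compDeg]
  rw [Finset.sum_sigma']
  refine Finset.sum_bij (fun x _ => x.2) ?_ ?_ ?_ ?_
  · rintro ⟨c', w⟩ hx
    exact Finset.mem_filter.2 ⟨Finset.mem_univ _,
      (Finset.mem_filter.1 (Finset.mem_sigma.1 hx).2).2.2⟩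
  · rintro ⟨c', w⟩ hx ⟨c'', w'⟩ hx' e
    simp only [Finset.mem_sigma, Finset.mem_filter, Finset.mem_univ, true_and] at hx hx' e
    subst e
    obtain ⟨_, h3, _⟩ := hx
    obtain ⟨_, h3', _⟩ := hx'
    subst h3
    subst h3'
    rfl
  · intro w hw
    simp only [Finset.mem_filter, Finset.mem_univ, true_and] at hw
    refine ⟨⟨Quotient.mk _ w, w⟩, ?_, rfl⟩
    exact Finset.mem_sigma.2 ⟨Finset.mem_filter.2
      ⟨Finset.mem_univ (α := (G'.contract (f.onE ⁻¹' F)).V) _,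
      congrArg (Quotient.mk (G.conn F)) hw⟩, Finset.mem_filter.2 ⟨Finset.mem_univ _, rfl, hw⟩⟩
  · intro _ _
    rfl

end HarmonicMorphism

/-- A harmonic morphism of metric graphs: a harmonic morphism of models whose slope along an edge
is the local degree. -/
structure MetricHarmonic (G' G : MetricGraph.{u}) extends
    HarmonicMorphism G'.toGraph G.toGraph where
  len_map : ∀ e, G.len (toHarmonicMorphism.onE e) = toHarmonicMorphism.degE e * G'.len e

/-! ### Jacobians and the norm homomorphism -/

section Homology

open scoped Classical in
/-- The simplicial homology group `H₁(G, ℤ)`. A chain is written as a function on half-edges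
(oriented edges) that changes sign under reversal, so that `γ(h)` is the coefficient of the edge
of `h` oriented away from the root of `h`; a chain is a cycle if at every vertex the coefficients
of the outgoing half-edges sum to zero. -/
def Graph.H1 (G : Graph.{u}) : Submodule ℤ (G.H → ℤ) where
  carrier := {c | (∀ h, c (G.inv h) = -c h) ∧ ∀ v, ∑ h with G.root h = v, c h = 0}
  add_mem' := by
    rintro a b ⟨ha, ha'⟩ ⟨hb, hb'⟩
    refine ⟨fun h => ?_, fun v => ?_⟩
    · simp [ha, hb, add_comm]
    · simp [Finset.sum_add_distrib, ha', hb']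
  zero_mem' := by simp
  smul_mem' := by
    rintro n a ⟨ha, ha'⟩
    refine ⟨fun h => ?_, fun v => ?_⟩
    · simp [ha]
    · simp [← Finset.mul_sum, ha']

/-- The integration pairing `[ω, γ] = ∑_e ω(e) γ(e) ℓ(e)` on half-edge functions. The sum over
edges is half of the sum over half-edges, because the summand does not depend on the orientation. -/
noncomputable def MetricGraph.integration (G : MetricGraph.{u}) :
    (G.H → ℤ) →ₗ[ℤ] (G.H → ℤ) →ₗ[ℤ] ℝ :=
  LinearMap.mk₂ ℤ (fun w c => ∑ h, (w h : ℝ) * c h * (G.len (G.edge h) / 2))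
    (by intros; simp [add_mul, Finset.sum_add_distrib])
    (by intros; simp [Finset.mul_sum, mul_assoc])
    (by intros; simp [add_mul, mul_add, Finset.sum_add_distrib])
    (by intros; simp [Finset.mul_sum, mul_assoc, mul_left_comm])

/-- The restriction of the integration pairing to `H₁`, where the group of tropical `1`-forms
`Ω¹` is identified with `H₁`. -/
noncomputable def MetricGraph.cyclePairing (G : MetricGraph.{u}) :
    G.H1 →ₗ[ℤ] G.H1 →ₗ[ℤ] ℝ :=
  G.integration.compl₁₂ G.H1.subtype G.H1.subtype

theorem MetricGraph.cyclePairing_posDef (G : MetricGraph.{u}) : IsPosDef G.cyclePairing :=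
  IsPosDef.comap (isPosDef_sum (fun h => G.len (G.edge h) / 2)
    (fun _ => half_pos (G.len_pos _)) G.integration (fun _ _ => rfl))
    G.H1.subtype (Submodule.subtype_injective _) _ (fun _ _ => rfl)

/-- The Jacobian `Jac(Γ) = (Ω¹, H₁(Γ, ℤ), [·,·])`, as an integral torus. -/
noncomputable def MetricGraph.jac (G : MetricGraph.{u}) : IntegralTorus.{u} where
  L := G.H1
  L' := G.H1
  pairing := G.cyclePairing
  nondeg := bijective_realPeriod _ (LinearEquiv.refl ℤ _) G.cyclePairing_posDef

/-- The principal polarization of the Jacobian: the identification `H₁(Γ, ℤ) = Ω¹`. -/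
noncomputable def MetricGraph.jacPolarization (G : MetricGraph.{u}) : Polarization G.jac where
  xi := LinearMap.id
  posDef := G.cyclePairing_posDef

variable {G' G : Graph.{u}} (f : HarmonicMorphism G' G)

open scoped Classical in
/-- The pushforward `f_*` on chains. -/
noncomputable def HarmonicMorphism.pushChain : (G'.H → ℤ) →ₗ[ℤ] (G.H → ℤ) where
  toFun c h := ∑ k with f.onH k = h, c k
  map_add' _ _ := by ext; simp [Finset.sum_add_distrib]
  map_smul' _ _ := by ext; simp [Finset.mul_sum]

/-- The pullback `f^*` on `1`-forms, which multiplies by the local degree. -/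
def HarmonicMorphism.pullForm : (G.H → ℤ) →ₗ[ℤ] (G'.H → ℤ) where
  toFun w k := f.degH k * w (f.onH k)
  map_add' _ _ := by ext; simp [mul_add]
  map_smul' _ _ := by ext; simp [mul_left_comm]

theorem HarmonicMorphism.pushChain_mem {c : G'.H → ℤ} (hc : c ∈ G'.H1) :
    f.pushChain c ∈ G.H1 := by
  classical
  refine ⟨fun h => ?_, fun v => ?_⟩
  · simp only [HarmonicMorphism.pushChain, LinearMap.coe_mk, AddHom.coe_mk]
    rw [← Finset.sum_neg_distrib]
    refine Finset.sum_nbij' G'.inv G'.inv ?_ ?_ ?_ ?_ ?_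
    · intro k hk
      simp only [Finset.mem_filter, Finset.mem_univ, true_and] at hk ⊢
      rw [f.map_inv, hk, G.inv_inv]
    · intro k hk
      simp only [Finset.mem_filter, Finset.mem_univ, true_and] at hk ⊢
      rw [f.map_inv, hk]
    · intro k _
      exact G'.inv_inv k
    · intro k _
      exact G'.inv_inv k
    · intro k _
      rw [hc.1, neg_neg]
  · have h1 : ∑ h with G.root h = v, f.pushChain c h
        = ∑ k with f.onV (G'.root k) = v, c k := by
      simp only [HarmonicMorphism.pushChain, LinearMap.coe_mk, AddHom.coe_mk, Finset.sum_filter]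
      rw [Finset.sum_congr rfl (g := fun h => ∑ k, if f.onH k = h then
        (if f.onV (G'.root k) = v then c k else 0) else 0)]
      · rw [Finset.sum_comm]
        simp
      · intro h _
        by_cases hv : G.root h = v
        · rw [if_pos hv]
          refine Finset.sum_congr rfl fun k _ => ?_
          by_cases hk : f.onH k = h
          · rw [if_pos hk, if_pos hk, if_pos (by rw [← f.map_root, hk, hv])]
          · rw [if_neg hk, if_neg hk]
        · rw [if_neg hv]
          symm
          refine Finset.sum_eq_zero fun k _ => ?_
          by_cases hk : f.onH k = h
          · rw [if_pos hk, if_neg (by rw [← f.map_root, hk]; exact hv)]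
          · rw [if_neg hk]
    rw [h1, ← Finset.sum_fiberwise_of_maps_to
      (t := Finset.univ.filter fun w => f.onV w = v) (g := G'.root) (fun k hk => by
        simpa using hk)]
    refine Finset.sum_eq_zero fun w hw => ?_
    rw [Finset.filter_filter, ← hc.2 w]
    refine Finset.sum_congr (Finset.filter_congr fun k _ => ?_) fun _ _ => rfl
    have hw' : f.onV w = v := by simpa using hw
    constructor
    · exact fun h => h.2
    · exact fun h => ⟨by rw [h]; exact hw', h⟩

theorem HarmonicMorphism.pullForm_mem {w : G.H → ℤ} (hw : w ∈ G.H1) :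
    f.pullForm w ∈ G'.H1 := by
  classical
  refine ⟨fun k => ?_, fun v => ?_⟩
  · simp [HarmonicMorphism.pullForm, f.degH_inv, f.map_inv, hw.1]
  · simp only [HarmonicMorphism.pullForm, LinearMap.coe_mk, AddHom.coe_mk]
    rw [← Finset.sum_fiberwise_of_maps_to
      (t := Finset.univ.filter fun h => G.root h = f.onV v) (g := f.onH) (fun k hk => by
        simp only [Finset.mem_filter, Finset.mem_univ, true_and] at hk ⊢
        rw [f.map_root, hk])]
    have : ∀ h ∈ Finset.univ.filter (fun h => G.root h = f.onV v),
        ∑ k ∈ Finset.univ.filter (fun k => G'.root k = v) with f.onH k = h,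
          (f.degH k : ℤ) * w (f.onH k) = f.degV v * w h := by
      intro h hh
      rw [f.balanced v h (by simpa using hh), Finset.filter_filter, Nat.cast_sum,
        Finset.sum_mul]
      refine Finset.sum_congr rfl fun k hk => ?_
      rw [(Finset.mem_filter.1 hk).2.2]
    rw [Finset.sum_congr rfl this, ← Finset.mul_sum, hw.2, mul_zero]

end Homology

/-- The norm homomorphism `Nm = (f^*, f_*) : Jac(Γ') → Jac(Γ)`. -/
noncomputable def MetricHarmonic.norm {G' G : MetricGraph.{u}} (f : MetricHarmonic G' G) :
    TorusHom G'.jac G.jac where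
  up := f.pullForm.restrict fun _ h => f.pullForm_mem h
  down := f.pushChain.restrict fun _ h => f.pushChain_mem h
  adj := by
    classical
    rintro ⟨w, hw⟩ ⟨c, hc⟩
    change ∑ k, ((f.pullForm w k : ℤ) : ℝ) * c k * (G'.len (G'.edge k) / 2)
      = ∑ h, (w h : ℝ) * (f.pushChain c h : ℤ) * (G.len (G.edge h) / 2)
    rw [← Finset.sum_fiberwise_of_maps_to (s := Finset.univ) (t := Finset.univ) (g := f.onH)
      (fun _ _ => Finset.mem_univ _)]
    refine Finset.sum_congr rfl fun h _ => ?_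
    simp only [HarmonicMorphism.pushChain, HarmonicMorphism.pullForm, LinearMap.coe_mk,
      AddHom.coe_mk, Int.cast_sum, Finset.mul_sum, Finset.sum_mul]
    refine Finset.sum_congr rfl fun k hk => ?_
    have hk' : f.onH k = h := (Finset.mem_filter.1 hk).2
    have h1 := f.len_map (G'.edge k)
    rw [HarmonicMorphism.onE_edge, hk', HarmonicMorphism.degE_edge] at h1
    rw [hk', h1]
    push_cast
    ring

/-! ### Double covers, Prym varieties, and the signed cographic matroid -/

/-- A double cover `π : Γ̃ → Γ` of metric graphs: a harmonic morphism of global degree two. -/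
structure DoubleCover : Type (u + 1) where
  src : MetricGraph.{u}
  tgt : MetricGraph.{u}
  map : MetricHarmonic src tgt
  degree_two : map.HasDegree 2

namespace DoubleCover
variable (p : DoubleCover.{u})

/-- The tropical Prym variety: the kernel torus of the norm homomorphism, with the polarization
induced from the principal polarization of `Jac(Γ̃)`. -/
noncomputable def prym : PolarizedTorus.{u} where
  torus := p.map.norm.kernelTorus
  pol := p.src.jacPolarization.induced p.map.norm.kernelIncl (Submodule.subtype_injective _)

/-- The principalization of the tropical Prym variety. -/
noncomputable def prymP : PolarizedTorus.{u} := p.prym.principalization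

/-- The undilated edges of `Γ`: those over which the local degrees are one. -/
def undilated : Set p.tgt.E := {e | ∀ e', p.map.onE e' = e → p.map.degE e' = 1}

/-- The cover obtained by removing the edges `F` and their preimages is relatively connected: the
preimage of each connected component of `Γ \ F` is connected in `Γ̃ \ π⁻¹(F)`. -/
def RelConn (F : Set p.tgt.E) : Prop :=
  ∀ v w, p.tgt.conn Fᶜ (p.map.onV v) (p.map.onV w) → p.src.conn (p.map.onE ⁻¹' F)ᶜ v w

/-- The independent sets of the signed cographic matroid `M*(Γ̃/Γ)`: sets of undilated edges that
can be removed so that the cover remains relatively connected. -/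
def Indep (F : Set p.tgt.E) : Prop := F ⊆ p.undilated ∧ p.RelConn F

/-- The circuits of `M*(Γ̃/Γ)`: the minimal dependent subsets of its ground set, the set of
undilated edges. -/
def IsCircuit (C : Set p.tgt.E) : Prop :=
  Minimal (fun F => F ⊆ p.undilated ∧ ¬ p.Indep F) C

/-- The index of a set of edges: the number of connected components of its complement. -/
noncomputable def ind (F : Set p.tgt.E) : ℕ := p.tgt.numComponents F

/-- The multiplicity of an edge. -/
noncomputable def mult (e : p.tgt.E) : ℕ := 2 ^ (p.ind {e} - p.ind ∅)

/-- The contraction of a double cover along a set `F` of edges of the target, and along the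
preimage of `F` in the source. -/
noncomputable def contract (F : Set p.tgt.E) : DoubleCover.{u} where
  src := p.src.contract (p.map.onE ⁻¹' F)
  tgt := p.tgt.contract F
  map :=
    { toHarmonicMorphism := p.map.toHarmonicMorphism.contract F
      len_map := by
        intro e
        obtain ⟨h, rfl⟩ := Graph.edge_surjective _ e
        exact p.map.len_map (p.src.edge h.1) }
  degree_two := p.map.toHarmonicMorphism.contract_hasDegree F p.degree_two

/-- The double cover with new edge lengths on `Γ` (which determine the edge lengths on `Γ̃`). -/
noncomputable def withLen (len : p.tgt.E → ℝ) (hlen : ∀ e, 0 < len e) : DoubleCover.{u} where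
  src :=
    { toGraph := p.src.toGraph
      len := fun e => len (p.map.onE e) / p.map.degE e
      len_pos := fun e => div_pos (hlen _) (Nat.cast_pos.2 (p.map.degE_pos e)) }
  tgt := { toGraph := p.tgt.toGraph, len := len, len_pos := hlen }
  map :=
    { toHarmonicMorphism := p.map.toHarmonicMorphism
      len_map := fun e => (mul_div_cancel₀ _
        (Nat.cast_ne_zero.2 (p.map.degE_pos e).ne')).symm }
  degree_two := p.degree_two

/-- The new length of the remaining edge `f₂` when `f₁` is contracted. -/
noncomputable def newLen (f₁ f₂ : p.tgt.E) : ℝ :=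
  p.tgt.len f₂ + ((p.mult f₁ : ℝ) / p.mult f₂) ^ 2 * p.tgt.len f₁

theorem newLen_pos (f₁ f₂ : p.tgt.E) : 0 < p.newLen f₁ f₂ :=
  add_pos_of_pos_of_nonneg (p.tgt.len_pos _) (mul_nonneg (sq_nonneg _) (p.tgt.len_pos _).le)

open scoped Classical in
/-- The edge lengths of `Γ` after replacing that of `f₂`. -/
noncomputable def stepLen (f₁ f₂ : p.tgt.E) : p.tgt.E → ℝ :=
  Function.update p.tgt.len f₂ (p.newLen f₁ f₂)

theorem stepLen_pos (f₁ f₂ e : p.tgt.E) : 0 < p.stepLen f₁ f₂ e := by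
  classical
  unfold stepLen
  by_cases h : e = f₂
  · subst h
    rw [Function.update_self]
    exact p.newLen_pos _ _
  · rw [Function.update_of_ne h]
    exact p.tgt.len_pos e

/-- The double cover obtained by redefining the length of `f₂` and contracting `f₁`. -/
noncomputable def contractStep (f₁ f₂ : p.tgt.E) : DoubleCover.{u} :=
  (p.withLen (p.stepLen f₁ f₂) (p.stepLen_pos f₁ f₂)).contract {f₁}

/-- One step of the simplification: in a `2`-circuit `{f₁, f₂}` of `M*(Γ̃/Γ)`, contract `f₁` and
redefine the length of `f₂`. Here `f₁` is not allowed to be an edge of multiplicity one paired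
with an edge `f₂` of multiplicity two. -/
def Step (p q : DoubleCover.{u}) : Prop :=
  ∃ f₁ f₂ : p.tgt.E, f₁ ≠ f₂ ∧ p.IsCircuit {f₁, f₂} ∧ ¬ (p.mult f₁ = 1 ∧ p.mult f₂ = 2) ∧
    q = p.contractStep f₁ f₂

/-- `q` is a simplification of `p`: it is obtained by contracting all `1`-circuits of `M*(Γ̃/Γ)`
and then processing `2`-circuits, one at a time, until none are left. -/
def IsSimplification (p q : DoubleCover.{u}) : Prop :=
  Relation.ReflTransGen Step (p.contract {e | p.IsCircuit {e}}) q ∧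
    ¬ ∃ f₁ f₂ : q.tgt.E, f₁ ≠ f₂ ∧ q.IsCircuit {f₁, f₂}

end DoubleCover

end TropicalPrym

/-! Principalizing replaces `Λ` by `Im ξ`, so a principalized Prym variety is determined up to
isomorphism by the lattice `Ker π_*` with its form `[ξ(·), ·]`. This lattice consists of the
antisymmetric cycles, those cycles of the source with zero pushforward (`antiCycles`), and the form
is the integration pairing. It is enough that every contraction in a simplification induces an
isometry of these lattices (`Isometric`).

The isometry is restriction of cycles to the surviving edges. A cycle `c` of the contraction always
lifts to a cycle `d`. If `c` is antisymmetric, then `2d - π^*π_* d` is antisymmetric and restricts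
to `2c`. Hence restriction is bijective once values off the contracted edges detect both vanishing
and evenness (`bijective_restrictAntiCycles`).

Both properties come from conservation of flow. If `F` is a circuit, some component `A` of `Γ \ F`
has disconnected preimage. As the degree is two, a component of this preimage has degree one over
`A`. The net flow of an antisymmetric cycle out of that component is zero, and each edge of `F`
enters this relation with coefficient plus or minus the number of its ends on `A` (`exists_flux`).
Therefore an antisymmetric cycle vanishes over a `1`-circuit. Over a `2`-circuit its values are
proportional, up to sign, to the multiplicities (`exists_proportional`). This proportionality gives
the squared ratio in the new length, and it transfers evenness from `f₂` to `f₁` except for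
multiplicities `1` and `2`, the excluded order. -/

namespace TropicalPrym

/-! ### Cycles of a graph and of its contractions. -/

namespace Graph
variable {G : Graph.{u}}

theorem edge_eq_edge {h k : G.H} : G.edge h = G.edge k ↔ k = h ∨ k = G.inv h :=
  Quotient.eq (r := G.edgeSetoid)

theorem sum_eq_zero_of_inv (s : Finset G.H) (hs : ∀ h ∈ s, G.inv h ∈ s) (c : G.H → ℤ)
    (hc : ∀ h ∈ s, c (G.inv h) = -c h) : ∑ h ∈ s, c h = 0 :=
  Finset.sum_involution (fun h _ => G.inv h) (fun h hh => by rw [hc h hh, add_neg_cancel])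
    (fun h _ _ => G.inv_ne h) hs (fun h _ => G.inv_inv h)

open scoped Classical in
/-- A union of components of `G` with edges `S`: the flow of a cycle through it is carried by
the remaining edges. -/
theorem sum_root_mem_eq_zero {c : G.H → ℤ} (hc : c ∈ G.H1) (P : G.V → Prop) (S : Set G.E)
    (hP : ∀ h, G.edge h ∈ S → P (G.root h) → P (G.root (G.inv h))) :
    ∑ h with P (G.root h) ∧ G.edge h ∉ S, c h = 0 := by
  have h1 : ∑ h with P (G.root h), c h = 0 := by
    rw [← Finset.sum_fiberwise_of_maps_to (t := Finset.univ.filter P) (g := G.root)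
      (fun h hh => by simpa using hh)]
    refine Finset.sum_eq_zero fun v hv => ?_
    rw [← hc.2 v, Finset.filter_filter]
    refine Finset.sum_congr (Finset.filter_congr fun h _ => ?_) fun _ _ => rfl
    exact ⟨fun h => h.2, fun h => ⟨by rw [h]; exact (Finset.mem_filter.1 hv).2, h⟩⟩
  -- Both ends of such an edge satisfy `P`, so its two orientations cancel.
  have h2 : ∑ h with P (G.root h) ∧ G.edge h ∈ S, c h = 0 := by
    refine sum_eq_zero_of_inv _ (fun h hh => ?_) _ fun h _ => hc.1 h
    simp only [Finset.mem_filter, Finset.mem_univ, true_and] at hh ⊢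
    exact ⟨hP h hh.2 hh.1, by rw [G.edge_inv]; exact hh.2⟩
  rw [← Finset.sum_filter_add_sum_filter_not _ (fun h => G.edge h ∈ S), Finset.filter_filter,
    Finset.filter_filter, h2, zero_add] at h1
  exact h1

theorem mem_H1_contract {c : G.H → ℤ} (hc : c ∈ G.H1) (F : Set G.E) :
    (fun h : (G.contract F).H => c h.1) ∈ (G.contract F).H1 := by
  classical
  refine ⟨fun h => hc.1 h.1, fun v => ?_⟩
  rw [← sum_root_mem_eq_zero hc (fun w => Quotient.mk (G.conn F) w = v) F
    (fun h hh hv => (Quotient.sound (Setoid.symm' _ (G.conn_root hh))).trans hv)]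
  refine Finset.sum_bij (fun h _ => h.1) ?_ ?_ ?_ ?_
  · intro h hh
    exact Finset.mem_filter.2 ⟨Finset.mem_univ _, (Finset.mem_filter.1 hh).2, h.2⟩
  · intro h _ k _ e
    exact Subtype.ext e
  · intro h hh
    obtain ⟨h1, h2⟩ := (Finset.mem_filter.1 hh).2
    exact ⟨⟨h, h2⟩, Finset.mem_filter.2 ⟨Finset.mem_univ _, h1⟩, rfl⟩
  · intro _ _
    rfl

open scoped Classical in
/-- The boundary of a function on half-edges. -/
noncomputable def outflow (G : Graph.{u}) : (G.H → ℤ) →ₗ[ℤ] (G.V → ℤ) where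
  toFun c v := ∑ h with G.root h = v, c h
  map_add' _ _ := by ext; simp [Finset.sum_add_distrib]
  map_smul' _ _ := by ext; simp [Finset.mul_sum]

open scoped Classical in
theorem outflow_single (h : G.H) : G.outflow (Pi.single h 1) = Pi.single (G.root h) 1 := by
  ext v
  by_cases hv : v = G.root h
  · subst hv
    simp [outflow]
  · simp [outflow, Pi.single_apply, hv, Ne.symm hv]

/-- Alternating chains supported on `F`. -/
def chainsOn (F : Set G.E) : Submodule ℤ (G.H → ℤ) where
  carrier := {c | (∀ h, c (G.inv h) = -c h) ∧ ∀ h, G.edge h ∉ F → c h = 0}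
  add_mem' := by
    rintro a b ⟨ha, ha'⟩ ⟨hb, hb'⟩
    exact ⟨fun h => by simp [ha, hb, add_comm], fun h hh => by simp [ha' h hh, hb' h hh]⟩
  zero_mem' := by simp
  smul_mem' := by
    rintro n a ⟨ha, ha'⟩
    exact ⟨fun h => by simp [ha], fun h hh => by simp [ha' h hh]⟩

open scoped Classical in
theorem single_sub_single_mem (F : Set G.E) {v w : G.V} (h : G.conn F v w) :
    (Pi.single v 1 - Pi.single w 1 : G.V → ℤ) ∈ (chainsOn F).map G.outflow := by
  induction h with
  | rel v w h =>
    obtain ⟨h, hh, rfl, rfl⟩ := h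
    refine ⟨Pi.single h 1 - Pi.single (G.inv h) 1, ⟨fun k => ?_, fun k hk => ?_⟩, ?_⟩
    · have h1 : G.inv k = h ↔ k = G.inv h :=
        ⟨fun e => by rw [← e, G.inv_inv], fun e => by rw [e, G.inv_inv]⟩
      have h2 : G.inv k = G.inv h ↔ k = h :=
        ⟨fun e => by rw [← G.inv_inv k, e, G.inv_inv], fun e => by rw [e]⟩
      simp only [Pi.sub_apply, Pi.single_apply, h1, h2, neg_sub]
    · have h1 : k ≠ h := fun e => hk (e ▸ hh)
      have h2 : k ≠ G.inv h := fun e => hk (by rw [e, G.edge_inv]; exact hh)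
      simp [h1, h2]
    · rw [map_sub, outflow_single, outflow_single]
  | refl v => simp
  | symm v w _ ih => simpa using neg_mem ih
  | trans u v w _ _ ih1 ih2 => simpa using add_mem ih1 ih2

open scoped Classical in
-- Moving all mass of `b` to one chosen vertex in each component of `F` costs only boundaries of
-- chains on `F`, and the mass collected there is zero.
theorem exists_outflow_eq (F : Set G.E) (b : G.V → ℤ)
    (hb : ∀ x, ∑ v with Quotient.mk (G.conn F) v = x, b v = 0) :
    b ∈ (chainsOn F).map G.outflow := by
  have h1 : b = ∑ v, b v • (Pi.single v 1 - Pi.single (Quotient.mk (G.conn F) v).out 1) := by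
    have h2 : ∑ v, b v • (Pi.single (Quotient.mk (G.conn F) v).out 1 : G.V → ℤ) = 0 := by
      rw [← Finset.sum_fiberwise_of_maps_to (t := Finset.univ)
        (g := Quotient.mk (G.conn F)) (fun _ _ => Finset.mem_univ _)]
      refine Finset.sum_eq_zero fun x _ => ?_
      rw [Finset.sum_congr rfl (g := fun v => b v • (Pi.single x.out 1 : G.V → ℤ))
        (fun v hv => by rw [(Finset.mem_filter.1 hv).2]), ← Finset.sum_smul, hb, zero_smul]
    simp only [smul_sub, Finset.sum_sub_distrib, h2, sub_zero]
    ext w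
    simp [Finset.sum_apply, Pi.single_apply]
  rw [h1]
  exact sum_mem fun v _ => Submodule.smul_mem _ _
    (single_sub_single_mem F (Setoid.symm' _ (Quotient.mk_out (s := G.conn F) v)))

/-- Cycles of a contraction lift to cycles. -/
theorem exists_mem_H1_extending (F : Set G.E) {c : (G.contract F).H → ℤ}
    (hc : c ∈ (G.contract F).H1) : ∃ d ∈ G.H1, ∀ h : (G.contract F).H, d h.1 = c h := by
  classical
  -- Extension by zero. Its boundary sums to zero on each component of `F`, because `c` is a cycle
  -- after contraction, so a chain on `F` can cancel it.
  let c₀ : G.H → ℤ := fun h => if hh : G.edge h ∉ F then c ⟨h, hh⟩ else 0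
  have hc₀ : ∀ h : (G.contract F).H, c₀ h.1 = c h := fun h => dif_pos h.2
  have hinv : ∀ h, c₀ (G.inv h) = -c₀ h := by
    intro h
    by_cases hh : G.edge h ∉ F
    · exact (hc₀ ((G.contract F).inv ⟨h, hh⟩)).trans ((hc.1 _).trans (congrArg Neg.neg (hc₀ ⟨h, hh⟩).symm))
    · have hh' : ¬ G.edge (G.inv h) ∉ F := by rwa [G.edge_inv]
      simp only [c₀, dif_neg hh, dif_neg hh', neg_zero]
  obtain ⟨d, ⟨hd1, hd2⟩, hd⟩ := exists_outflow_eq F (G.outflow c₀) (by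
    intro x
    rw [← hc.2 x]
    have h1 : ∑ v with Quotient.mk (G.conn F) v = x, G.outflow c₀ v
        = ∑ h with Quotient.mk (G.conn F) (G.root h) = x, c₀ h := by
      rw [← Finset.sum_fiberwise_of_maps_to
        (t := Finset.univ.filter fun v => Quotient.mk (G.conn F) v = x) (g := G.root)
        (fun h hh => by simpa using hh)]
      refine Finset.sum_congr rfl fun v hv => ?_
      rw [Finset.filter_filter]
      refine Finset.sum_congr (Finset.filter_congr fun h _ => ?_) fun _ _ => rfl
      exact ⟨fun h => ⟨by rw [h]; exact (Finset.mem_filter.1 hv).2, h⟩, fun h => h.2⟩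
    rw [h1]
    symm
    refine Finset.sum_bij_ne_zero (fun h _ _ => h.1) ?_ ?_ ?_ ?_
    · intro h hh _
      exact Finset.mem_filter.2 ⟨Finset.mem_univ _, (Finset.mem_filter.1 hh).2⟩
    · intro h _ _ k _ _ e
      exact Subtype.ext e
    · intro h hh hne
      have hF : G.edge h ∉ F := by
        by_contra hF
        exact hne (dif_neg (not_not.2 hF))
      refine ⟨⟨h, hF⟩, Finset.mem_filter.2 ⟨Finset.mem_univ _, (Finset.mem_filter.1 hh).2⟩, ?_,
        rfl⟩
      exact fun e => hne ((hc₀ ⟨h, hF⟩).trans e)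
    · intro h _ _
      exact (hc₀ h).symm)
  refine ⟨c₀ - d, ⟨fun h => ?_, fun v => ?_⟩, fun h => ?_⟩
  · simp only [Pi.sub_apply, hinv, hd1]
    ring
  · have h2 := congrFun hd v
    simp only [outflow, LinearMap.coe_mk, AddHom.coe_mk] at h2
    simp only [Pi.sub_apply, Finset.sum_sub_distrib, h2, sub_self]
  · simp only [Pi.sub_apply, hc₀, hd2 h.1 h.2, sub_zero]

end Graph

/-! ### Antisymmetric cycles under contraction. -/

namespace HarmonicMorphism
variable {G' G : Graph.{u}} (f : HarmonicMorphism G' G)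

/-- The cycles with trivial pushforward. -/
noncomputable def antiCycles : Submodule ℤ (G'.H → ℤ) := G'.H1 ⊓ LinearMap.ker f.pushChain

open scoped Classical in
theorem pushChain_apply (c : G'.H → ℤ) (h : G.H) :
    f.pushChain c h = ∑ k with f.onH k = h, c k := rfl

theorem pullForm_apply (w : G.H → ℤ) (k : G'.H) : f.pullForm w k = f.degH k * w (f.onH k) := rfl

open scoped Classical in
variable {f} in
theorem HasDegree.sum_degH {n : ℕ} (hn : f.HasDegree n) (h : G.H) :
    ∑ k with f.onH k = h, f.degH k = n := by
  rw [← hn (G.root h), ← Finset.sum_fiberwise_of_maps_to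
    (t := Finset.univ.filter fun w => f.onV w = G.root h) (g := G'.root) (fun k hk => by
      simp only [Finset.mem_filter, Finset.mem_univ, true_and] at hk ⊢
      rw [← f.map_root, hk])]
  refine Finset.sum_congr rfl fun w hw => ?_
  rw [f.balanced w h (Finset.mem_filter.1 hw).2.symm, Finset.filter_filter]
  exact Finset.sum_congr (Finset.filter_congr fun _ _ => and_comm) fun _ _ => rfl

variable {f} in
theorem HasDegree.pushChain_pullForm {n : ℕ} (hn : f.HasDegree n) (w : G.H → ℤ) :
    f.pushChain (f.pullForm w) = (n : ℤ) • w := by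
  classical
  ext h
  rw [f.pushChain_apply, Pi.smul_apply, smul_eq_mul, ← hn.sum_degH h, Nat.cast_sum,
    Finset.sum_mul]
  refine Finset.sum_congr rfl fun k hk => ?_
  rw [pullForm_apply, (Finset.mem_filter.1 hk).2]

theorem pushChain_contract (F : Set G.E) (c : G'.H → ℤ) (h : (G.contract F).H) :
    (f.contract F).pushChain (fun k => c k.1) h = f.pushChain c h.1 := by
  classical
  rw [pushChain_apply, pushChain_apply]
  refine Finset.sum_bij (fun k _ => k.1) ?_ ?_ ?_ ?_
  · intro k hk
    exact Finset.mem_filter.2 ⟨Finset.mem_univ _,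
      congrArg Subtype.val (Finset.mem_filter.1 hk).2⟩
  · intro k _ k' _ e
    exact Subtype.ext e
  · intro k hk
    have hk' := (Finset.mem_filter.1 hk).2
    refine ⟨⟨k, ?_⟩, Finset.mem_filter.2 ⟨Finset.mem_univ _, Subtype.ext hk'⟩, rfl⟩
    rw [Set.mem_preimage, f.onE_edge, hk']
    exact h.2
  · intro _ _
    rfl

/-- Restriction of cycles to the edges that are not contracted. -/
noncomputable def restrictAntiCycles (F : Set G.E) :
    f.antiCycles →ₗ[ℤ] (f.contract F).antiCycles where
  toFun c := ⟨fun k => c.1 k.1, G'.mem_H1_contract c.2.1 _, by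
    refine LinearMap.mem_ker.2 (funext fun h => ?_)
    rw [f.pushChain_contract, LinearMap.mem_ker.1 c.2.2]
    rfl⟩
  map_add' _ _ := rfl
  map_smul' _ _ := rfl

variable {f} in
/-- Twice an antisymmetric cycle of the contraction lifts to an antisymmetric cycle. -/
theorem HasDegree.exists_antiCycle_extending (hf : f.HasDegree 2) (F : Set G.E)
    (c : (f.contract F).antiCycles) :
    ∃ d : f.antiCycles, ∀ k : (G'.contract (f.onE ⁻¹' F)).H, d.1 k.1 = 2 * c.1 k := by
  obtain ⟨d, hd, hdc⟩ := G'.exists_mem_H1_extending _ c.2.1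
  -- Since `π_* π^*` is multiplication by two, subtracting the pullback of the pushforward from `2d`
  -- kills the pushforward.
  refine ⟨⟨(2 : ℤ) • d - f.pullForm (f.pushChain d), sub_mem (Submodule.smul_mem _ _ hd)
    (f.pullForm_mem (f.pushChain_mem hd)), ?_⟩, fun k => ?_⟩
  · refine LinearMap.mem_ker.2 ?_
    rw [map_sub, map_smul, hf.pushChain_pullForm, Nat.cast_ofNat, sub_self]
  -- Off `F` the pushforward of `d` is that of `c`, which is zero, so the correction term is
  -- invisible there.
  · have h1 : f.pushChain d (f.onH k.1) = 0 := by
      have h2 := f.pushChain_contract F d ⟨f.onH k.1, k.2⟩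
      rw [← h2, show (fun k : (G'.contract (f.onE ⁻¹' F)).H => d k.1) = c.1 from funext hdc,
        LinearMap.mem_ker.1 c.2.2]
      rfl
    simp [pullForm_apply, h1, hdc]

variable {f} in
-- `h0` is injectivity. For surjectivity, `h2` makes the antisymmetric lift of `2c` divisible by
-- two, and its half lifts `c`.
theorem HasDegree.bijective_restrictAntiCycles (hf : f.HasDegree 2) (F : Set G.E)
    (h0 : ∀ c ∈ f.antiCycles, (∀ k, f.onE (G'.edge k) ∉ F → c k = 0) → c = 0)
    (h2 : ∀ c ∈ f.antiCycles, (∀ k, f.onE (G'.edge k) ∉ F → 2 ∣ c k) → ∀ k, 2 ∣ c k) :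
    Function.Bijective (f.restrictAntiCycles F) := by
  constructor
  · rw [← LinearMap.ker_eq_bot, LinearMap.ker_eq_bot']
    intro c hc
    refine Subtype.ext (h0 c.1 c.2 fun k hk => ?_)
    exact congrFun (congrArg Subtype.val hc) ⟨k, hk⟩
  · intro c
    obtain ⟨⟨d, hd, hd'⟩, hdc⟩ := hf.exists_antiCycle_extending F c
    choose d' hd'' using h2 d ⟨hd, hd'⟩ fun k hk => ⟨_, hdc ⟨k, hk⟩⟩
    have hdd : d = (2 : ℤ) • d' := funext hd''
    have h3 : d' ∈ f.antiCycles := by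
      refine ⟨⟨fun h => ?_, fun v => ?_⟩, ?_⟩
      · have := hd.1 h
        rw [hd'', hd''] at this
        omega
      · have := hd.2 v
        simp only [hd'', ← Finset.mul_sum] at this
        omega
      · have h4 := LinearMap.mem_ker.1 hd'
        rw [hdd, map_smul] at h4
        exact (smul_eq_zero.1 h4).resolve_left two_ne_zero
    refine ⟨⟨d', h3⟩, Subtype.ext (funext fun k => ?_)⟩
    have h5 := (hd'' k.1).symm.trans (hdc k)
    exact mul_left_cancel₀ two_ne_zero h5

end HarmonicMorphism

/-! ### Connectivity after deleting one or two edges. -/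

namespace Graph
variable {G : Graph.{u}}

theorem conn_mono {S T : Set G.E} (hST : S ⊆ T) {v w : G.V} (h : G.conn S v w) :
    G.conn T v w := by
  induction h with
  | rel v w h =>
    obtain ⟨k, hk, rfl, rfl⟩ := h
    exact G.conn_root (hST hk)
  | refl v => exact Setoid.refl' _ _
  | symm v w _ ih => exact Setoid.symm' _ ih
  | trans u v w _ _ ih1 ih2 => exact Setoid.trans' _ ih1 ih2

theorem iff_of_conn {S : Set G.E} (P : G.V → Prop)
    (hP : ∀ h, G.edge h ∈ S → P (G.root h) → P (G.root (G.inv h))) {v w : G.V}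
    (h : G.conn S v w) : P v ↔ P w := by
  induction h with
  | rel v w h =>
    obtain ⟨k, hk, rfl, rfl⟩ := h
    refine ⟨hP k hk, fun hw => ?_⟩
    have := hP (G.inv k) (by rwa [G.edge_inv]) hw
    rwa [G.inv_inv] at this
  | refl v => exact Iff.rfl
  | symm v w _ ih => exact ih.symm
  | trans u v w _ _ ih1 ih2 => exact ih1.trans ih2

theorem Connected.conn_or (hG : G.Connected) (h : G.H) (v : G.V) :
    G.conn {G.edge h}ᶜ v (G.root h) ∨ G.conn {G.edge h}ᶜ v (G.root (G.inv h)) := by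
  refine (G.iff_of_conn (fun v => G.conn {G.edge h}ᶜ v (G.root h) ∨
    G.conn {G.edge h}ᶜ v (G.root (G.inv h))) ?_ (hG.2 (G.root h) v)).1 (Or.inl (Setoid.refl' _ _))
  intro k _ hk
  by_cases he : G.edge k = G.edge h
  · rcases G.edge_eq_edge.1 he with rfl | rfl
    · exact Or.inr (Setoid.refl' _ _)
    · exact Or.inl (Setoid.refl' _ _)
  · exact hk.imp (fun h1 => Setoid.trans' _ (Setoid.symm' _ (G.conn_root he)) h1)
      (fun h1 => Setoid.trans' _ (Setoid.symm' _ (G.conn_root he)) h1)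

theorem Connected.numComponents_empty (hG : G.Connected) : G.numComponents ∅ = 1 := by
  obtain ⟨⟨v⟩, hG⟩ := hG
  rw [numComponents, Nat.card_eq_one_iff_exists]
  refine ⟨Quotient.mk _ v, fun x => ?_⟩
  obtain ⟨w, rfl⟩ := Quotient.exists_rep x
  exact Quotient.sound (G.conn_mono (by simp) (hG w v))

open scoped Classical in
theorem Connected.numComponents_singleton (hG : G.Connected) (h : G.H) :
    G.numComponents {G.edge h} =
      if G.conn {G.edge h}ᶜ (G.root h) (G.root (G.inv h)) then 1 else 2 := by
  rw [numComponents]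
  split_ifs with hh
  · rw [Nat.card_eq_one_iff_exists]
    refine ⟨Quotient.mk _ (G.root h), fun x => ?_⟩
    obtain ⟨w, rfl⟩ := Quotient.exists_rep x
    exact Quotient.sound ((hG.conn_or h w).elim id fun h1 => Setoid.trans' _ h1 (Setoid.symm' _ hh))
  · rw [Nat.card_eq_two_iff]
    refine ⟨Quotient.mk _ (G.root h), Quotient.mk _ (G.root (G.inv h)),
      fun e => hh (Quotient.exact e), Set.eq_univ_of_forall fun x => ?_⟩
    obtain ⟨w, rfl⟩ := Quotient.exists_rep x
    exact (hG.conn_or h w).imp (fun h1 => Quotient.sound h1) (fun h1 => Quotient.sound h1)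

/-- If two edges `h₁, h₂` leave a component of the complement of both, and `h₁` is not a bridge,
then neither is `h₂`. -/
theorem not_bridge_of_pair {u : G.V} {h₁ h₂ : G.H} (hne : G.edge h₁ ≠ G.edge h₂)
    (hu₁ : G.conn {G.edge h₁, G.edge h₂}ᶜ u (G.root h₁))
    (hu₂ : G.conn {G.edge h₁, G.edge h₂}ᶜ u (G.root h₂))
    (hq : ¬ G.conn {G.edge h₁, G.edge h₂}ᶜ u (G.root (G.inv h₁)))
    (hb : G.conn {G.edge h₁}ᶜ (G.root h₁) (G.root (G.inv h₁))) :
    ¬ G.conn {G.edge h₁, G.edge h₂}ᶜ u (G.root (G.inv h₂)) ∧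
      G.conn {G.edge h₂}ᶜ (G.root h₂) (G.root (G.inv h₂)) := by
  -- A walk around `h₁` that avoids its edge leaves the component of `u` only through the edge of
  -- `h₂`, so it stays within the component of `u` and that of the far end of `h₂`.
  have key : G.conn {G.edge h₁, G.edge h₂}ᶜ (G.root (G.inv h₂)) (G.root (G.inv h₁)) := by
    have h3 := (G.iff_of_conn (fun v => G.conn {G.edge h₁, G.edge h₂}ᶜ u v ∨
      G.conn {G.edge h₁, G.edge h₂}ᶜ (G.root (G.inv h₂)) v) ?_ hb).1 (Or.inl hu₁)
    · exact h3.resolve_left hq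
    · intro k hk1 hk
      by_cases he : G.edge k = G.edge h₂
      · rcases G.edge_eq_edge.1 he with h | h
        · rw [← h]
          exact Or.inr (Setoid.refl' _ _)
        · rw [← h]
          exact Or.inl hu₂
      · have hk2 : G.edge k ∈ ({G.edge h₁, G.edge h₂} : Set G.E)ᶜ := by
          rintro (h | h)
          exacts [hk1 h, he h]
        exact hk.imp (fun h1 => Setoid.trans' _ h1 (G.conn_root hk2))
          (fun h1 => Setoid.trans' _ h1 (G.conn_root hk2))
  refine ⟨fun h => hq (Setoid.trans' _ h key), ?_⟩
  have hsub : ({G.edge h₁, G.edge h₂} : Set G.E)ᶜ ⊆ {G.edge h₂}ᶜ :=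
    Set.compl_subset_compl.2 (by simp)
  -- The detour around `h₂` passes through the component of `u`, crosses `h₁`, and continues from
  -- its far end to that of `h₂`.
  refine Setoid.trans' _ (G.conn_mono hsub (Setoid.trans' _ (Setoid.symm' _ hu₂) hu₁))
    (Setoid.trans' _ (G.conn_root (h := h₁) hne) (Setoid.symm' _ (G.conn_mono hsub key)))

end Graph

/-! ### Lifts of undilated edges, and the flow through a cut. -/

namespace HarmonicMorphism
variable {G' G : Graph.{u}} (f : HarmonicMorphism G' G)

/-- The two half-edges above an undilated half-edge. -/
structure LiftPair (h : G.H) where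
  fst : G'.H
  snd : G'.H
  ne : fst ≠ snd
  onH_eq_iff : ∀ k, f.onH k = h ↔ k = fst ∨ k = snd

variable {f}

theorem HasDegree.nonempty_liftPair (hf : f.HasDegree 2) {h : G.H}
    (hh : ∀ e', f.onE e' = G.edge h → f.degE e' = 1) : Nonempty (f.LiftPair h) := by
  classical
  have h1 := hf.sum_degH h
  rw [Finset.sum_congr rfl (f := f.degH) (g := fun _ => 1) (fun k hk => hh (G'.edge k)
    (by rw [f.onE_edge, (Finset.mem_filter.1 hk).2])), ← Finset.card_eq_sum_ones,
    Finset.card_eq_two] at h1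
  obtain ⟨k₁, k₂, hne, h2⟩ := h1
  exact ⟨⟨k₁, k₂, hne, fun k => by simpa using Finset.ext_iff.1 h2 k⟩⟩

namespace LiftPair
variable {h : G.H} (L : f.LiftPair h)

theorem onH_fst : f.onH L.fst = h := (L.onH_eq_iff _).2 (Or.inl rfl)

theorem onH_snd : f.onH L.snd = h := (L.onH_eq_iff _).2 (Or.inr rfl)

theorem onE_eq_iff (k : G'.H) : f.onE (G'.edge k) = G.edge h ↔
    k = L.fst ∨ k = L.snd ∨ k = G'.inv L.fst ∨ k = G'.inv L.snd := by
  have h1 : ∀ l, G'.inv k = l ↔ k = G'.inv l := fun l =>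
    ⟨fun e => by rw [← e, G'.inv_inv], fun e => by rw [e, G'.inv_inv]⟩
  rw [f.onE_edge, eq_comm, G.edge_eq_edge, L.onH_eq_iff, ← or_assoc, ← h1, ← h1,
    ← L.onH_eq_iff (G'.inv k), f.map_inv]
  refine or_congr Iff.rfl ⟨fun e => by rw [e, G.inv_inv], fun e => by rw [← e, G.inv_inv]⟩

open scoped Classical in
theorem sum_eq {M : Type*} [AddCommMonoid M] (φ : G'.H → M) :
    ∑ k with f.onE (G'.edge k) = G.edge h, φ k =
      φ L.fst + (φ L.snd + (φ (G'.inv L.fst) + φ (G'.inv L.snd))) := by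
  have h1 : ∀ k l, f.onH k = h → f.onH l = h → k ≠ G'.inv l := by
    rintro k l hk hl rfl
    rw [f.map_inv, hl] at hk
    exact G.inv_ne h hk
  have h2 : G'.inv L.fst ≠ G'.inv L.snd := fun e =>
    L.ne (by rw [← G'.inv_inv L.fst, e, G'.inv_inv])
  have h3 : (Finset.univ.filter fun k => f.onE (G'.edge k) = G.edge h) =
      {L.fst, L.snd, G'.inv L.fst, G'.inv L.snd} := by
    ext k
    simp [L.onE_eq_iff]
  rw [h3, Finset.sum_insert, Finset.sum_insert, Finset.sum_insert, Finset.sum_singleton]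
  · simpa using h2
  · simpa using ⟨h1 _ _ L.onH_snd L.onH_fst, h1 _ _ L.onH_snd L.onH_snd⟩
  · simpa using ⟨L.ne, h1 _ _ L.onH_fst L.onH_fst, h1 _ _ L.onH_fst L.onH_snd⟩

theorem snd_eq_neg {c : G'.H → ℤ} (hc : c ∈ f.antiCycles) : c L.snd = -c L.fst := by
  classical
  have h1 := congrFun (LinearMap.mem_ker.1 hc.2) h
  rw [f.pushChain_apply, show (Finset.univ.filter fun k => f.onH k = h) = {L.fst, L.snd} by
    ext k; simp [L.onH_eq_iff], Finset.sum_pair L.ne] at h1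
  exact (neg_eq_of_add_eq_zero_right h1).symm

/-- The flux coefficient of an antisymmetric chain through the boundary of `χ`. -/
def flux (χ : G'.V → ℤ) : ℤ :=
  χ (G'.root L.fst) - χ (G'.root L.snd) - χ (G'.root (G'.inv L.fst)) + χ (G'.root (G'.inv L.snd))

open scoped Classical in
theorem sum_flux (χ : G'.V → ℤ) {c : G'.H → ℤ} (hc : c ∈ f.antiCycles) :
    ∑ k with f.onE (G'.edge k) = G.edge h, χ (G'.root k) * c k = c L.fst * L.flux χ := by
  rw [L.sum_eq, hc.1.1, hc.1.1, L.snd_eq_neg hc, flux]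
  ring

end LiftPair

variable (f) in
open scoped Classical in
-- Reversing a half-edge and exchanging the two lifts each negate both cycles, so the product is the
-- same on all four half-edges.
theorem sum_over_eq {h : G.H} (L : f.LiftPair h) {k : G'.H} (hk : f.onE (G'.edge k) = G.edge h)
    {c c' : G'.H → ℤ} (hc : c ∈ f.antiCycles) (hc' : c' ∈ f.antiCycles) :
    ∑ k with f.onE (G'.edge k) = G.edge h, c k * c' k = 4 * (c k * c' k) := by
  rw [L.sum_eq]
  rcases (L.onE_eq_iff k).1 hk with rfl | rfl | rfl | rfl <;>
  · simp only [hc.1.1, hc'.1.1, L.snd_eq_neg hc, L.snd_eq_neg hc']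
    ring

theorem eq_or_eq_neg {h : G.H} (L : f.LiftPair h) {k k' : G'.H}
    (hk : f.onE (G'.edge k) = G.edge h) (hk' : f.onE (G'.edge k') = G.edge h)
    {c : G'.H → ℤ} (hc : c ∈ f.antiCycles) : c k' = c k ∨ c k' = -c k := by
  rcases (L.onE_eq_iff k).1 hk with rfl | rfl | rfl | rfl <;>
  rcases (L.onE_eq_iff k').1 hk' with rfl | rfl | rfl | rfl <;>
  simp [hc.1.1, L.snd_eq_neg hc]

section Cut
variable {F : Set G.E} {v₀ w₀ : G'.V}

open scoped Classical in
/-- A component of a disconnected preimage maps with degree one. -/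
theorem HasDegree.compDeg_eq (hf : f.HasDegree 2) (hc : G.conn Fᶜ (f.onV v₀) (f.onV w₀))
    (hn : ¬ G'.conn (f.onE ⁻¹' F)ᶜ v₀ w₀) (v : G.V) :
    f.compDeg Fᶜ (Quotient.mk _ v₀) v = if G.conn Fᶜ (f.onV v₀) v then 1 else 0 := by
  split_ifs with hv
  · rw [← f.compDeg_congr _ _ hv]
    have pos : ∀ w, 0 < f.compDeg Fᶜ (Quotient.mk _ w) (f.onV w) := fun w =>
      Finset.sum_pos (fun _ _ => f.degV_pos _) ⟨w, by simp⟩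
    have h2 := pos w₀
    rw [← f.compDeg_congr _ _ hc] at h2
    -- The components of `v₀` and `w₀` are distinct and lie over the same component of the target,
    -- so their positive degrees add up to at most two; each is one.
    have h3 : f.compDeg Fᶜ (Quotient.mk _ v₀) (f.onV v₀)
        + f.compDeg Fᶜ (Quotient.mk _ w₀) (f.onV v₀) ≤ 2 := by
      rw [compDeg, compDeg, ← hf (f.onV v₀), ← Finset.sum_union]
      · refine Finset.sum_le_sum_of_subset fun w hw => ?_
        simp only [Finset.mem_union, Finset.mem_filter, Finset.mem_univ, true_and] at hw ⊢
        exact hw.elim And.right And.right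
      · refine Finset.disjoint_left.2 fun w hw hw' => hn ?_
        exact Quotient.exact (s := G'.conn (f.onE ⁻¹' Fᶜ))
          ((Finset.mem_filter.1 hw).2.1.symm.trans (Finset.mem_filter.1 hw').2.1)
    have h1 := pos v₀
    omega
  · refine Finset.sum_eq_zero fun w hw => absurd ?_ hv
    obtain ⟨h1, rfl⟩ := (Finset.mem_filter.1 hw).2
    exact Setoid.symm' _ (f.conn_map (Quotient.exact h1))

variable (f F v₀) in
open scoped Classical in
/-- The indicator function of the component of `v₀` in the complement of the preimage of `F`. -/
noncomputable def cut (v : G'.V) : ℤ := if G'.conn (f.onE ⁻¹' F)ᶜ v₀ v then 1 else 0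

theorem cut_eq_one_iff {v : G'.V} : f.cut F v₀ v = 1 ↔ G'.conn (f.onE ⁻¹' F)ᶜ v₀ v := by
  simp [cut]

theorem cut_eq_or (v : G'.V) : f.cut F v₀ v = 0 ∨ f.cut F v₀ v = 1 := by
  unfold cut
  split_ifs <;> simp

open scoped Classical in
-- This is conservation of flow for the component of `v₀`: edges not above `F` do not leave it, and
-- their two orientations cancel.
theorem sum_cut_mul {c : G'.H → ℤ} (hc : c ∈ G'.H1) :
    ∑ k with f.onE (G'.edge k) ∈ F, f.cut F v₀ (G'.root k) * c k = 0 := by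
  rw [← G'.sum_root_mem_eq_zero hc (fun v => G'.conn (f.onE ⁻¹' F)ᶜ v₀ v) (f.onE ⁻¹' F)ᶜ
    (fun h hh hv => Setoid.trans' _ hv (G'.conn_root hh)), Finset.sum_filter, Finset.sum_filter]
  refine Finset.sum_congr rfl fun k _ => ?_
  simp only [cut, Set.mem_compl_iff, Set.mem_preimage, not_not]
  by_cases h1 : f.onE (G'.edge k) ∈ F <;>
  by_cases h2 : G'.conn (f.onE ⁻¹' F)ᶜ v₀ (G'.root k) <;> simp [h1, h2]

open scoped Classical in
-- The component of `v₀` has degree one over its image, and so does each lift of `h`; hence exactly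
-- one lift starts in it when `h` starts in that image, and none otherwise.
theorem HasDegree.cut_add_cut (hf : f.HasDegree 2) (hc : G.conn Fᶜ (f.onV v₀) (f.onV w₀))
    (hn : ¬ G'.conn (f.onE ⁻¹' F)ᶜ v₀ w₀) {h : G.H}
    (hh : ∀ e', f.onE e' = G.edge h → f.degE e' = 1) (L : f.LiftPair h) :
    f.cut F v₀ (G'.root L.fst) + f.cut F v₀ (G'.root L.snd) =
      if G.conn Fᶜ (f.onV v₀) (G.root h) then 1 else 0 := by
  have h1 := hf.compDeg_eq hc hn (G.root h)
  rw [f.compDeg_root, Finset.sum_congr rfl (f := f.degH) (g := fun _ => 1) (fun k hk => hh (G'.edge k)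
    (by rw [f.onE_edge, (Finset.mem_filter.1 hk).2.2])), ← Finset.filter_filter,
    Finset.filter_comm, Finset.sum_filter, show (Finset.univ.filter fun k => f.onH k = h)
      = {L.fst, L.snd} by ext k; simp [L.onH_eq_iff], Finset.sum_pair L.ne] at h1
  have h2 : ∀ v, (Quotient.mk (G'.conn (f.onE ⁻¹' Fᶜ)) v = Quotient.mk _ v₀) ↔
      G'.conn (f.onE ⁻¹' F)ᶜ v₀ v := fun v =>
    ⟨fun e => Setoid.symm' _ (Quotient.exact e), fun e => Quotient.sound (Setoid.symm' _ e)⟩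
  simp only [h2] at h1
  simp only [cut]
  exact_mod_cast h1

end Cut

end HarmonicMorphism

namespace HarmonicMorphism
variable {G' G : Graph.{u}} {f : HarmonicMorphism G' G}

/-- The lifts of the opposite half-edge. -/
def LiftPair.inv {h : G.H} (L : f.LiftPair h) : f.LiftPair (G.inv h) where
  fst := G'.inv L.fst
  snd := G'.inv L.snd
  ne e := L.ne (by rw [← G'.inv_inv L.fst, e, G'.inv_inv])
  onH_eq_iff k := by
    have h1 : ∀ l, G'.inv k = l ↔ k = G'.inv l := fun l =>
      ⟨fun e => by rw [← e, G'.inv_inv], fun e => by rw [e, G'.inv_inv]⟩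
    rw [← h1, ← h1, ← L.onH_eq_iff, f.map_inv]
    exact ⟨fun e => by rw [e, G.inv_inv], fun e => by rw [← e, G.inv_inv]⟩

section Cut
variable {F : Set G.E} {v₀ w₀ : G'.V}

/-- With zero flux, no lift of `h` leaves the component of `v₀`. Restoring the edge of `h` would
then not connect `v₀` to `w₀`, against `hr`. -/
theorem HasDegree.flux_ne_zero (hf : f.HasDegree 2) (hc : G.conn Fᶜ (f.onV v₀) (f.onV w₀))
    (hn : ¬ G'.conn (f.onE ⁻¹' F)ᶜ v₀ w₀) {h : G.H}
    (hh : ∀ e', f.onE e' = G.edge h → f.degE e' = 1)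
    (hr : G'.conn (f.onE ⁻¹' (F \ {G.edge h}))ᶜ v₀ w₀) (L : f.LiftPair h) :
    L.flux (f.cut F v₀) ≠ 0 := by
  intro h0
  have h1 := hf.cut_add_cut hc hn hh L
  have h2 := hf.cut_add_cut hc hn (h := G.inv h) (by rwa [G.edge_inv]) L.inv
  -- Each sum of two cut values is `0` or `1` and has the parity of their difference. Equal
  -- differences therefore force equal sums, hence equal values.
  have h3 : f.cut F v₀ (G'.root L.fst) = f.cut F v₀ (G'.root (G'.inv L.fst)) ∧
      f.cut F v₀ (G'.root L.snd) = f.cut F v₀ (G'.root (G'.inv L.snd)) := by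
    simp only [LiftPair.flux] at h0
    simp only [LiftPair.inv] at h2
    have c1 := f.cut_eq_or (F := F) (v₀ := v₀) (G'.root L.fst)
    have c2 := f.cut_eq_or (F := F) (v₀ := v₀) (G'.root L.snd)
    have c3 := f.cut_eq_or (F := F) (v₀ := v₀) (G'.root (G'.inv L.fst))
    have c4 := f.cut_eq_or (F := F) (v₀ := v₀) (G'.root (G'.inv L.snd))
    split_ifs at h1 h2 <;> omega
  refine hn ((G'.iff_of_conn (fun v => G'.conn (f.onE ⁻¹' F)ᶜ v₀ v) (fun k hk hv => ?_) hr).1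
    (Setoid.refl' _ _))
  by_cases he : f.onE (G'.edge k) = G.edge h
  · rw [← cut_eq_one_iff] at hv ⊢
    rcases (L.onE_eq_iff k).1 he with rfl | rfl | rfl | rfl
    · rwa [← h3.1]
    · rwa [← h3.2]
    · rwa [G'.inv_inv, h3.1]
    · rwa [G'.inv_inv, h3.2]
  · exact Setoid.trans' _ hv (G'.conn_root fun hk' => hk ⟨hk', he⟩)

open scoped Classical in
-- Each end of `h` on the component of `f v₀` contributes `±1`, an end elsewhere contributes
-- nothing. With two such ends the contributions cannot cancel, by `flux_ne_zero`.
theorem HasDegree.flux_eq (hf : f.HasDegree 2) (hc : G.conn Fᶜ (f.onV v₀) (f.onV w₀))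
    (hn : ¬ G'.conn (f.onE ⁻¹' F)ᶜ v₀ w₀) {h : G.H}
    (hh : ∀ e', f.onE e' = G.edge h → f.degE e' = 1)
    (hr : G'.conn (f.onE ⁻¹' (F \ {G.edge h}))ᶜ v₀ w₀)
    (hA : G.conn Fᶜ (f.onV v₀) (G.root h)) (L : f.LiftPair h) :
    L.flux (f.cut F v₀) = (if G.conn Fᶜ (f.onV v₀) (G.root (G.inv h)) then 2 else 1) ∨
    L.flux (f.cut F v₀) = -(if G.conn Fᶜ (f.onV v₀) (G.root (G.inv h)) then 2 else 1) := by
  have h0 := hf.flux_ne_zero hc hn hh hr L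
  have h1 := hf.cut_add_cut hc hn hh L
  have h2 := hf.cut_add_cut hc hn (h := G.inv h) (by rwa [G.edge_inv]) L.inv
  rw [if_pos hA] at h1
  simp only [LiftPair.flux] at h0 ⊢
  simp only [LiftPair.inv] at h2
  have c1 := f.cut_eq_or (F := F) (v₀ := v₀) (G'.root L.fst)
  have c2 := f.cut_eq_or (F := F) (v₀ := v₀) (G'.root L.snd)
  have c3 := f.cut_eq_or (F := F) (v₀ := v₀) (G'.root (G'.inv L.fst))
  have c4 := f.cut_eq_or (F := F) (v₀ := v₀) (G'.root (G'.inv L.snd))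
  split_ifs at h2 ⊢ <;> omega

/-- An edge of `F` whose removal makes `F` fail to separate `v₀` from `w₀` meets the component of
`f v₀` in the complement of `F`. -/
theorem HasDegree.conn_root_or (hf : f.HasDegree 2) (hc : G.conn Fᶜ (f.onV v₀) (f.onV w₀))
    (hn : ¬ G'.conn (f.onE ⁻¹' F)ᶜ v₀ w₀) {h : G.H}
    (hh : ∀ e', f.onE e' = G.edge h → f.degE e' = 1)
    (hr : G'.conn (f.onE ⁻¹' (F \ {G.edge h}))ᶜ v₀ w₀) :
    G.conn Fᶜ (f.onV v₀) (G.root h) ∨ G.conn Fᶜ (f.onV v₀) (G.root (G.inv h)) := by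
  obtain ⟨L⟩ := hf.nonempty_liftPair hh
  by_contra! hA
  have h0 := hf.flux_ne_zero hc hn hh hr L
  have h1 := hf.cut_add_cut hc hn hh L
  have h2 := hf.cut_add_cut hc hn (h := G.inv h) (by rwa [G.edge_inv]) L.inv
  rw [if_neg hA.1] at h1
  rw [if_neg hA.2] at h2
  simp only [LiftPair.flux] at h0
  simp only [LiftPair.inv] at h2
  have c1 := f.cut_eq_or (F := F) (v₀ := v₀) (G'.root L.fst)
  have c2 := f.cut_eq_or (F := F) (v₀ := v₀) (G'.root L.snd)
  have c3 := f.cut_eq_or (F := F) (v₀ := v₀) (G'.root (G'.inv L.fst))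
  have c4 := f.cut_eq_or (F := F) (v₀ := v₀) (G'.root (G'.inv L.snd))
  omega

end Cut

theorem HasDegree.surjective_onV (hf : f.HasDegree 2) : Function.Surjective f.onV := by
  classical
  intro v
  by_contra! h
  have := hf v
  rw [Finset.filter_false_of_mem (fun w _ => h w)] at this
  simp at this

theorem HasDegree.connected (hf : f.HasDegree 2) (h : G'.Connected) : G.Connected := by
  obtain ⟨⟨v⟩, h⟩ := h
  refine ⟨⟨f.onV v⟩, fun x y => ?_⟩
  obtain ⟨x, rfl⟩ := hf.surjective_onV x
  obtain ⟨y, rfl⟩ := hf.surjective_onV y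
  exact f.conn_map (F := Set.univ) (h x y)

end HarmonicMorphism

/-! ### Linear relations imposed by circuits on antisymmetric cycles. -/

namespace DoubleCover
variable {p : DoubleCover.{u}}

theorem nonempty_liftPair {h : p.tgt.H} (hh : p.tgt.edge h ∈ p.undilated) :
    Nonempty (p.map.LiftPair h) :=
  p.degree_two.nonempty_liftPair hh

open scoped Classical in
theorem mult_edge (hp : p.src.Connected) (h : p.tgt.H) : p.mult (p.tgt.edge h) =
    if p.tgt.conn {p.tgt.edge h}ᶜ (p.tgt.root h) (p.tgt.root (p.tgt.inv h)) then 1 else 2 := by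
  have ht := p.degree_two.connected hp
  rw [mult, ind, ind, ht.numComponents_empty, ht.numComponents_singleton]
  split_ifs <;> rfl

theorem mult_eq_one_or (hp : p.src.Connected) (e : p.tgt.E) : p.mult e = 1 ∨ p.mult e = 2 := by
  obtain ⟨h, rfl⟩ := p.tgt.edge_surjective e
  rw [mult_edge hp]
  split_ifs <;> simp

theorem IsCircuit.subset_undilated {F : Set p.tgt.E} (hF : p.IsCircuit F) : F ⊆ p.undilated :=
  hF.1.1

theorem IsCircuit.relConn_diff {F : Set p.tgt.E} (hF : p.IsCircuit F) {e : p.tgt.E} (he : e ∈ F) :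
    p.RelConn (F \ {e}) := by
  by_contra h
  have h1 : F ⊆ F \ {e} := hF.2 ⟨Set.sdiff_subset.trans hF.1.1, fun h2 => h h2.2⟩ Set.sdiff_subset
  exact (h1 he).2 rfl

open scoped Classical in
-- Together with `sum_cut_mul` this yields one linear relation among the values of `c` over `F`.
-- Dependence of `F` supplies the cut, and minimality makes every coefficient `κ` nonzero.
theorem IsCircuit.exists_flux {F : Set p.tgt.E} (hF : p.IsCircuit F) :
    ∃ v₀ : p.src.V, ∀ e ∈ F, ∃ (h : p.tgt.H) (k : p.src.H) (κ : ℤ), p.tgt.edge h = e ∧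
      p.map.onE (p.src.edge k) = e ∧ p.tgt.conn Fᶜ (p.map.onV v₀) (p.tgt.root h) ∧
      (κ = (if p.tgt.conn Fᶜ (p.map.onV v₀) (p.tgt.root (p.tgt.inv h)) then 2 else 1) ∨
        κ = -(if p.tgt.conn Fᶜ (p.map.onV v₀) (p.tgt.root (p.tgt.inv h)) then 2 else 1)) ∧
      ∀ c ∈ p.map.antiCycles, ∑ k' with p.map.onE (p.src.edge k') = e,
        p.map.cut F v₀ (p.src.root k') * c k' = c k * κ := by
  have hdep : ¬ p.RelConn F := fun h => hF.1.2 ⟨hF.1.1, h⟩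
  unfold RelConn at hdep
  push Not at hdep
  obtain ⟨v₀, w₀, hc, hn⟩ := hdep
  refine ⟨v₀, fun e he => ?_⟩
  -- By minimality the cover without `F \ {e}` is relatively connected, so restoring `e` joins `v₀`
  -- to `w₀`.
  have hr : p.src.conn (p.map.onE ⁻¹' (F \ {e}))ᶜ v₀ w₀ := hF.relConn_diff he v₀ w₀
    (p.tgt.conn_mono (Set.compl_subset_compl.2 Set.sdiff_subset) hc)
  obtain ⟨h, rfl, hA⟩ : ∃ h, p.tgt.edge h = e ∧
      p.tgt.conn Fᶜ (p.map.onV v₀) (p.tgt.root h) := by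
    obtain ⟨h, rfl⟩ := p.tgt.edge_surjective e
    rcases p.degree_two.conn_root_or hc hn (hF.1.1 he) hr with h1 | h1
    · exact ⟨h, rfl, h1⟩
    · exact ⟨p.tgt.inv h, p.tgt.edge_inv h, h1⟩
  obtain ⟨L⟩ := p.nonempty_liftPair (hF.1.1 he)
  exact ⟨h, L.fst, L.flux (p.map.cut F v₀), rfl, by rw [p.map.onE_edge, L.onH_fst], hA,
    p.degree_two.flux_eq hc hn (hF.1.1 he) hr hA L, fun c hc' => L.sum_flux _ hc'⟩

theorem eq_or_eq_neg {e : p.tgt.E} (he : e ∈ p.undilated) {k k' : p.src.H}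
    (hk : p.map.onE (p.src.edge k) = e) (hk' : p.map.onE (p.src.edge k') = e)
    {c : p.src.H → ℤ} (hc : c ∈ p.map.antiCycles) : c k' = c k ∨ c k' = -c k := by
  obtain ⟨h, rfl⟩ := p.tgt.edge_surjective e
  obtain ⟨L⟩ := p.nonempty_liftPair he
  exact HarmonicMorphism.eq_or_eq_neg L hk hk' hc

/-- Antisymmetric cycles vanish over a `1`-circuit. -/
theorem IsCircuit.eq_zero_of_singleton {e : p.tgt.E} (he : p.IsCircuit {e})
    {c : p.src.H → ℤ} (hc : c ∈ p.map.antiCycles) {k : p.src.H}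
    (hk : p.map.onE (p.src.edge k) = e) : c k = 0 := by
  classical
  obtain ⟨v₀, hv⟩ := he.exists_flux
  obtain ⟨h, k', κ, -, hk', -, hκ, hs⟩ := hv e rfl
  have h1 := p.map.sum_cut_mul (F := {e}) (v₀ := v₀) hc.1
  simp only [Set.mem_singleton_iff] at h1
  rw [hs c hc] at h1
  have hκ0 : κ ≠ 0 := by
    intro h0
    split_ifs at hκ <;> omega
  have h2 : c k' = 0 := (mul_eq_zero.1 h1).resolve_right hκ0
  rcases eq_or_eq_neg (he.1.1 rfl) hk' hk hc with h3 | h3 <;> rw [h3, h2]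
  exact neg_zero

/-- The multiplicities of the edges of a `2`-circuit are inversely proportional to the numbers of
their ends on a component of the complement with disconnected preimage. -/
theorem ends_mul_mult (hp : p.src.Connected) {h₁ h₂ : p.tgt.H} {u : p.tgt.V}
    (hne : p.tgt.edge h₁ ≠ p.tgt.edge h₂)
    (hu₁ : p.tgt.conn {p.tgt.edge h₁, p.tgt.edge h₂}ᶜ u (p.tgt.root h₁))
    (hu₂ : p.tgt.conn {p.tgt.edge h₁, p.tgt.edge h₂}ᶜ u (p.tgt.root h₂)) {n₁ n₂ : ℤ}
    [Decidable (p.tgt.conn {p.tgt.edge h₁, p.tgt.edge h₂}ᶜ u (p.tgt.root (p.tgt.inv h₁)))]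
    [Decidable (p.tgt.conn {p.tgt.edge h₁, p.tgt.edge h₂}ᶜ u (p.tgt.root (p.tgt.inv h₂)))]
    (hn₁ : n₁ = if p.tgt.conn {p.tgt.edge h₁, p.tgt.edge h₂}ᶜ u (p.tgt.root (p.tgt.inv h₁))
      then 2 else 1)
    (hn₂ : n₂ = if p.tgt.conn {p.tgt.edge h₁, p.tgt.edge h₂}ᶜ u (p.tgt.root (p.tgt.inv h₂))
      then 2 else 1) :
    n₁ * p.mult (p.tgt.edge h₁) = n₂ * p.mult (p.tgt.edge h₂) := by
  classical
  have key₁ := p.tgt.not_bridge_of_pair hne hu₁ hu₂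
  have key₂ := p.tgt.not_bridge_of_pair (u := u) hne.symm (by rwa [Set.pair_comm])
    (by rwa [Set.pair_comm])
  rw [Set.pair_comm] at key₂
  have hb₁ : p.tgt.conn {p.tgt.edge h₁, p.tgt.edge h₂}ᶜ u (p.tgt.root (p.tgt.inv h₁)) →
      p.tgt.conn {p.tgt.edge h₁}ᶜ (p.tgt.root h₁) (p.tgt.root (p.tgt.inv h₁)) := fun h =>
    p.tgt.conn_mono (Set.compl_subset_compl.2 (by simp))
      (Setoid.trans' _ (Setoid.symm' _ hu₁) h)
  have hb₂ : p.tgt.conn {p.tgt.edge h₁, p.tgt.edge h₂}ᶜ u (p.tgt.root (p.tgt.inv h₂)) →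
      p.tgt.conn {p.tgt.edge h₂}ᶜ (p.tgt.root h₂) (p.tgt.root (p.tgt.inv h₂)) := fun h =>
    p.tgt.conn_mono (Set.compl_subset_compl.2 (by simp))
      (Setoid.trans' _ (Setoid.symm' _ hu₂) h)
  -- An edge with both ends on the component is not a bridge, so each product is `1` or `2`. It is
  -- `1` just for a non-bridge with one end there, and by `key₁` and `key₂` this holds for both
  -- edges or neither.
  rw [hn₁, hn₂, mult_edge hp, mult_edge hp]
  split_ifs <;> first | rfl | (exfalso; tauto)

/-- The values of an antisymmetric cycle over the edges of a `2`-circuit are proportional to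
the multiplicities. -/
theorem IsCircuit.exists_proportional (hp : p.src.Connected) {e₁ e₂ : p.tgt.E} (hne : e₁ ≠ e₂)
    (hF : p.IsCircuit {e₁, e₂}) : ∃ k₁ k₂ : p.src.H, p.map.onE (p.src.edge k₁) = e₁ ∧
      p.map.onE (p.src.edge k₂) = e₂ ∧ ∀ c ∈ p.map.antiCycles,
        c k₁ * p.mult e₂ = c k₂ * p.mult e₁ := by
  classical
  obtain ⟨v₀, hv⟩ := hF.exists_flux
  obtain ⟨h₁, k₁, κ₁, rfl, hk₁, hu₁, hκ₁, hs₁⟩ := hv e₁ (by simp)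
  obtain ⟨h₂, k₂, κ₂, rfl, hk₂, hu₂, hκ₂, hs₂⟩ := hv e₂ (by simp)
  have hn := ends_mul_mult hp hne hu₁ hu₂ rfl rfl
  set n₁ : ℤ := if p.tgt.conn {p.tgt.edge h₁, p.tgt.edge h₂}ᶜ (p.map.onV v₀)
    (p.tgt.root (p.tgt.inv h₁)) then 2 else 1 with hn₁
  set n₂ : ℤ := if p.tgt.conn {p.tgt.edge h₁, p.tgt.edge h₂}ᶜ (p.map.onV v₀)
    (p.tgt.root (p.tgt.inv h₂)) then 2 else 1 with hn₂
  have hn0 : n₁ ≠ 0 := by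
    rw [hn₁]
    split_ifs <;> norm_num
  have hm0 : (p.mult (p.tgt.edge h₁) : ℤ) ≠ 0 := by
    rcases mult_eq_one_or hp (p.tgt.edge h₁) with h | h <;> rw [h] <;> norm_num
  have hsum : ∀ c ∈ p.map.antiCycles, c k₁ * κ₁ + c k₂ * κ₂ = 0 := by
    intro c hc
    rw [← hs₁ c hc, ← hs₂ c hc, ← Finset.sum_union, ← p.map.sum_cut_mul
      (F := {p.tgt.edge h₁, p.tgt.edge h₂}) (v₀ := v₀) hc.1]
    · refine Finset.sum_congr ?_ fun _ _ => rfl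
      ext k
      simp
    · refine Finset.disjoint_left.2 fun k h1 h2 => hne ?_
      rw [← (Finset.mem_filter.1 h1).2, (Finset.mem_filter.1 h2).2]
  have hfin : κ₁ * p.mult (p.tgt.edge h₁) = -(κ₂ * p.mult (p.tgt.edge h₂)) ∨
      κ₁ * p.mult (p.tgt.edge h₁) = κ₂ * p.mult (p.tgt.edge h₂) := by
    rcases hκ₁ with h1 | h1 <;> rcases hκ₂ with h2 | h2 <;> rw [h1, h2] <;> simp [hn]
  have hκ0 : κ₁ * p.mult (p.tgt.edge h₁) ≠ 0 := by
    refine mul_ne_zero ?_ hm0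
    rcases hκ₁ with h | h <;> rw [h] <;> simpa using hn0
  rcases hfin with h | h
  -- The relative sign of the coefficients decides whether `k₂` or its reverse makes the
  -- proportionality hold without a sign.
  · refine ⟨k₁, k₂, hk₁, hk₂, fun c hc => mul_left_cancel₀ hκ0 ?_⟩
    linear_combination (p.mult (p.tgt.edge h₁) * p.mult (p.tgt.edge h₂) : ℤ) * hsum c hc
      - (c k₂ * p.mult (p.tgt.edge h₁) : ℤ) * h
  · refine ⟨k₁, p.src.inv k₂, hk₁, by rw [p.src.edge_inv, hk₂], fun c hc =>
      mul_left_cancel₀ hκ0 ?_⟩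
    rw [hc.1.1]
    linear_combination (p.mult (p.tgt.edge h₁) * p.mult (p.tgt.edge h₂) : ℤ) * hsum c hc
      + (c k₂ * p.mult (p.tgt.edge h₁) : ℤ) * h

end DoubleCover

/-! ### Reduction to isometries of lattices of antisymmetric cycles. -/

/-- An isometry of the lattices `Λ'` induces an isomorphism of principalizations. -/
theorem PolarizedTorus.nonempty_iso_principalization {A B : PolarizedTorus.{u}}
    (e : A.torus.L' ≃ₗ[ℤ] B.torus.L')
    (he : ∀ x y, A.torus.pairing (A.pol.xi x) y = B.torus.pairing (B.pol.xi (e x)) (e y)) :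
    Nonempty (A.principalization.Iso B.principalization) := by
  let a := LinearEquiv.ofInjective A.pol.xi A.pol.injective
  let b := LinearEquiv.ofInjective B.pol.xi B.pol.injective
  -- Compatibility with the polarizations forces `ξ_A ∘ e⁻¹ ∘ ξ_B⁻¹`, which makes sense only on the
  -- images; this is where principalization is needed.
  let up : LinearMap.range B.pol.xi ≃ₗ[ℤ] LinearMap.range A.pol.xi := b.symm.trans (e.symm.trans a)
  have hup : ∀ x, up (b (e x)) = a x := fun x => by simp [up]
  refine ⟨{ hom := { up := up.toLinearMap, down := e.toLinearMap, adj := ?_ },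
            up_bij := up.bijective, down_bij := e.bijective, pol := hup }⟩
  intro x y
  obtain ⟨x, rfl⟩ := b.surjective x
  obtain ⟨x, rfl⟩ := e.surjective x
  refine Eq.trans ?_ (he x y)
  exact congrArg (fun z : LinearMap.range A.pol.xi => A.torus.pairing z.1 y) (hup x)

theorem Graph.Connected.contract {G : Graph.{u}} (hG : G.Connected) (F : Set G.E) :
    (G.contract F).Connected := by
  obtain ⟨⟨v⟩, hG⟩ := hG
  refine ⟨⟨Quotient.mk _ v⟩, fun x y => ?_⟩
  obtain ⟨x, rfl⟩ := Quotient.exists_rep x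
  obtain ⟨y, rfl⟩ := Quotient.exists_rep y
  refine (G.iff_of_conn (fun w => (G.contract F).conn Set.univ (Quotient.mk _ x)
    (Quotient.mk _ w)) (fun h _ hh => ?_) (hG x y)).1 (Setoid.refl' _ _)
  by_cases hF : G.edge h ∈ F
  · rwa [← Quotient.sound (s := G.conn F) (G.conn_root hF)]
  · exact Setoid.trans' _ hh ((G.contract F).conn_root (h := ⟨h, hF⟩) (Set.mem_univ _))

namespace DoubleCover
variable {p q r : DoubleCover.{u}}

/-- The lattices of antisymmetric cycles are isometric. -/
def Isometric (p q : DoubleCover.{u}) : Prop :=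
  ∃ e : p.map.antiCycles ≃ₗ[ℤ] q.map.antiCycles,
    ∀ x y, p.src.integration x.1 y.1 = q.src.integration (e x).1 (e y).1

theorem Isometric.refl (p : DoubleCover.{u}) : Isometric p p :=
  ⟨LinearEquiv.refl ℤ _, fun _ _ => rfl⟩

theorem Isometric.trans (h₁ : Isometric p q) (h₂ : Isometric q r) : Isometric p r := by
  obtain ⟨e₁, h₁⟩ := h₁
  obtain ⟨e₂, h₂⟩ := h₂
  exact ⟨e₁.trans e₂, fun x y => (h₁ x y).trans (h₂ _ _)⟩

/-- The kernel of the norm homomorphism consists of the antisymmetric cycles. -/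
noncomputable def kerNormEquiv (p : DoubleCover.{u}) :
    p.prym.torus.L' ≃ₗ[ℤ] p.map.antiCycles where
  toFun c := ⟨c.1.1, c.1.2, LinearMap.mem_ker.2
    (congrArg Subtype.val (show p.map.norm.down c.1 = 0 from c.2))⟩
  invFun c := ⟨⟨c.1, c.2.1⟩, show p.map.norm.down _ = 0 from
    Subtype.ext (LinearMap.mem_ker.1 c.2.2)⟩
  map_add' _ _ := rfl
  map_smul' _ _ := rfl
  left_inv _ := rfl
  right_inv _ := rfl

theorem Isometric.nonempty_iso (h : Isometric p q) : Nonempty (p.prymP.Iso q.prymP) := by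
  obtain ⟨e, he⟩ := h
  exact PolarizedTorus.nonempty_iso_principalization
    (p.kerNormEquiv.trans (e.trans q.kerNormEquiv.symm)) fun x y =>
      he (p.kerNormEquiv x) (p.kerNormEquiv y)

theorem len_src (p : DoubleCover.{u}) (k : p.src.H) : p.src.len (p.src.edge k) =
    p.tgt.len (p.map.onE (p.src.edge k)) / p.map.degH k := by
  rw [p.map.len_map, p.map.degE_edge, mul_div_cancel_left₀]
  exact Nat.cast_ne_zero.2 (p.map.degH_pos k).ne'

theorem integration_apply (p : DoubleCover.{u}) (x y : p.src.H → ℤ) : p.src.integration x y =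
    ∑ k, (x k : ℝ) * y k / (2 * p.map.degH k) * p.tgt.len (p.map.onE (p.src.edge k)) := by
  refine Finset.sum_congr rfl fun k _ => ?_
  rw [len_src, div_div, mul_comm (p.map.degH k : ℝ)]
  ring

open scoped Classical in
theorem integration_contract_apply (p : DoubleCover.{u}) (F : Set p.tgt.E) (x y : p.src.H → ℤ) :
    (p.contract F).src.integration (fun k => x k.1) (fun k => y k.1) =
    ∑ k with p.map.onE (p.src.edge k) ∉ F,
      (x k : ℝ) * y k / (2 * p.map.degH k) * p.tgt.len (p.map.onE (p.src.edge k)) := by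
  rw [integration_apply]
  exact (Finset.sum_subtype (p := fun k => p.src.edge k ∉ p.map.onE ⁻¹' F) _
    (fun k => by rw [Finset.mem_filter_univ, Set.mem_preimage]) (fun k => (x k : ℝ) * y k /
      (2 * p.map.degH k) * p.tgt.len (p.map.onE (p.src.edge k)))).symm

/-! ### Contractions as isometries. -/

theorem isometric_contract (p : DoubleCover.{u}) :
    Isometric p (p.contract {e | p.IsCircuit {e}}) := by
  classical
  have h0 : ∀ c ∈ p.map.antiCycles, ∀ k, p.map.onE (p.src.edge k) ∈ {e | p.IsCircuit {e}} →
      c k = 0 := fun c hc k hk => IsCircuit.eq_zero_of_singleton hk hc rfl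
  refine ⟨LinearEquiv.ofBijective (p.map.restrictAntiCycles _)
    (p.degree_two.bijective_restrictAntiCycles _ ?_ ?_), fun x y => ?_⟩
  · exact fun c hc h => funext fun k => if hk : _ then h0 c hc k hk else h k hk
  · exact fun c hc h k => if hk : _ then h0 c hc k hk ▸ dvd_zero 2 else h k hk
  · refine Eq.trans ?_ (integration_contract_apply p _ x.1 y.1).symm
    rw [integration_apply, Finset.sum_filter]
    refine Finset.sum_congr rfl fun k _ => ?_
    split_ifs with hk
    · rw [h0 x.1 x.2 k hk]
      simp
    · rfl

/-- The values over `e₁` are `m₁/m₂` times those over `e₂`, up to sign, so the part of the form over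
`e₁` can be absorbed into the length of `e₂`. -/
theorem isometric_contractStep (hp : p.src.Connected) {e₁ e₂ : p.tgt.E} (hne : e₁ ≠ e₂)
    (hF : p.IsCircuit {e₁, e₂}) (hm : ¬ (p.mult e₁ = 1 ∧ p.mult e₂ = 2)) :
    Isometric p (p.contractStep e₁ e₂) := by
  classical
  obtain ⟨k₁, k₂, hk₁, hk₂, hk⟩ := hF.exists_proportional hp hne
  have hu₁ : e₁ ∈ p.undilated := hF.subset_undilated (by simp)
  have hu₂ : e₂ ∈ p.undilated := hF.subset_undilated (by simp)
  have hm₁ := mult_eq_one_or hp e₁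
  have hm₂ := mult_eq_one_or hp e₂
  refine ⟨LinearEquiv.ofBijective (p.map.restrictAntiCycles {e₁})
    (p.degree_two.bijective_restrictAntiCycles _ ?_ ?_), fun x y => ?_⟩
  · intro c hc h
    have h2 : c k₂ = 0 := h k₂ (by rw [hk₂]; exact hne.symm)
    have h1 : c k₁ = 0 := by
      have := hk c hc
      rw [h2, zero_mul] at this
      refine (mul_eq_zero.1 this).resolve_right ?_
      rcases hm₂ with h | h <;> rw [h] <;> norm_num
    ext k
    by_cases hke : p.map.onE (p.src.edge k) = e₁
    · rcases eq_or_eq_neg hu₁ hk₁ hke hc with h3 | h3 <;> rw [h3, h1] <;> simp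
    · exact h k hke
  · intro c hc h k
    by_cases hke : p.map.onE (p.src.edge k) = e₁
    · have h2 : 2 ∣ c k₂ := h k₂ (by rw [hk₂]; exact hne.symm)
      -- For multiplicities `1` and `2` the relation reads `2 * c k₁ = c k₂`, and evenness of `c k₂`
      -- says nothing about `c k₁`. In all other cases `c k₁` is an integer multiple of `c k₂`.
      have h1 : 2 ∣ c k₁ := by
        have := hk c hc
        rcases hm₁ with h₁ | h₁ <;> rcases hm₂ with h₂ | h₂ <;> rw [h₁, h₂] at this <;>
          push_cast at this
        · omega
        · exact absurd ⟨h₁, h₂⟩ hm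
        · omega
        · omega
      rcases eq_or_eq_neg hu₁ hk₁ hke hc with h3 | h3 <;> rw [h3]
      · exact h1
      · exact (dvd_neg).2 h1
    · exact h k hke
  · refine Eq.trans ?_ (integration_contract_apply
      (p.withLen (p.stepLen e₁ e₂) (p.stepLen_pos e₁ e₂)) {e₁} x.1 y.1).symm
    change _ = ∑ k with p.map.onE (p.src.edge k) ≠ e₁, (x.1 k : ℝ) * y.1 k /
      (2 * p.map.degH k) * p.stepLen e₁ e₂ (p.map.onE (p.src.edge k))
    have hlen : ∀ e, p.stepLen e₁ e₂ e = p.tgt.len e +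
        if e = e₂ then ((p.mult e₁ : ℝ) / p.mult e₂) ^ 2 * p.tgt.len e₁ else 0 := by
      intro e
      rw [stepLen, Function.update_apply]
      split_ifs with h
      · rw [newLen, h]
      · rw [add_zero]
    -- Four half-edges of local degree one lie above `e`, each weighted by one half: the factor is
    -- `2`.
    have hover : ∀ e ∈ p.undilated, ∀ k₀, p.map.onE (p.src.edge k₀) = e → ∀ ℓ : ℝ,
        ∑ k with p.map.onE (p.src.edge k) = e,
          (x.1 k : ℝ) * y.1 k / (2 * p.map.degH k) * ℓ = 2 * (x.1 k₀ * y.1 k₀) * ℓ := by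
      intro e he k₀ hk₀ ℓ
      obtain ⟨h, rfl⟩ := p.tgt.edge_surjective e
      obtain ⟨L⟩ := p.nonempty_liftPair he
      have h1 := congrArg (Int.cast : ℤ → ℝ) (p.map.sum_over_eq L hk₀ x.2 y.2)
      push_cast at h1
      rw [← Finset.sum_mul, Finset.sum_congr rfl (g := fun k => (x.1 k : ℝ) * y.1 k / 2),
        ← Finset.sum_div, h1]
      · ring
      · intro k hk
        have h2 : p.map.degH k = 1 := he _ (Finset.mem_filter.1 hk).2
        rw [h2, Nat.cast_one, mul_one]
    have hfil : ((Finset.univ.filter fun k => p.map.onE (p.src.edge k) ≠ e₁).filter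
        fun k => p.map.onE (p.src.edge k) = e₂) =
        Finset.univ.filter fun k => p.map.onE (p.src.edge k) = e₂ := by
      rw [Finset.filter_filter]
      exact Finset.filter_congr fun k _ => ⟨And.right, fun h => ⟨h ▸ hne.symm, h⟩⟩
    rw [integration_apply, ← Finset.sum_filter_add_sum_filter_not _
      (fun k => p.map.onE (p.src.edge k) = e₁), Finset.sum_congr rfl
      (g := fun k => (x.1 k : ℝ) * y.1 k / (2 * p.map.degH k) * p.tgt.len e₁)
      (fun k hk => by rw [(Finset.mem_filter.1 hk).2]), hover e₁ hu₁ k₁ hk₁]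
    simp only [hlen, mul_add, Finset.sum_add_distrib, mul_ite, mul_zero]
    rw [← Finset.sum_filter, hfil, hover e₂ hu₂ k₂ hk₂, add_comm]
    congr 1
    have hm0 : (p.mult e₂ : ℝ) ≠ 0 := by
      rcases hm₂ with h | h <;> rw [h] <;> norm_num
    have hx := congrArg (Int.cast : ℤ → ℝ) (hk x.1 x.2)
    have hy := congrArg (Int.cast : ℤ → ℝ) (hk y.1 y.2)
    push_cast at hx hy
    field_simp
    linear_combination p.tgt.len e₁ * (y.1 k₁ * p.mult e₂ : ℝ) * hx +
      p.tgt.len e₁ * (x.1 k₂ * p.mult e₁ : ℝ) * hy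

theorem Step.isometric (h : Step p q) (hp : p.src.Connected) : Isometric p q := by
  obtain ⟨e₁, e₂, hne, hF, hm, rfl⟩ := h
  exact isometric_contractStep hp hne hF hm

theorem Step.connected (h : Step p q) (hp : p.src.Connected) : q.src.Connected := by
  obtain ⟨e₁, e₂, -, -, -, rfl⟩ := h
  exact Graph.Connected.contract hp _

theorem isometric_of_reflTransGen (h : Relation.ReflTransGen Step p q) (hp : p.src.Connected) :
    Isometric p q ∧ q.src.Connected := by
  induction h with
  | refl => exact ⟨Isometric.refl p, hp⟩
  | tail _ hs ih => exact ⟨ih.1.trans (hs.isometric ih.2), hs.connected ih.2⟩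

/-! ### Termination and existence of a simplification. -/

theorem Step.card_lt (h : Step p q) : Nat.card q.tgt.H < Nat.card p.tgt.H := by
  obtain ⟨e₁, e₂, -, -, -, rfl⟩ := h
  obtain ⟨h, rfl⟩ := p.tgt.edge_surjective e₁
  rw [Nat.card_eq_fintype_card (α := p.tgt.H)]
  change Nat.card {k : p.tgt.H // p.tgt.edge k ∉ ({p.tgt.edge h} : Set p.tgt.E)} < _
  classical
  rw [Nat.card_eq_fintype_card]
  exact Fintype.card_subtype_lt (x := h) (by simp)

theorem exists_reflTransGen_step (p : DoubleCover.{u}) :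
    ∃ q, Relation.ReflTransGen Step p q ∧
      ¬ ∃ f₁ f₂ : q.tgt.E, f₁ ≠ f₂ ∧ q.IsCircuit {f₁, f₂} := by
  induction hn : Nat.card p.tgt.H using Nat.strong_induction_on generalizing p with
  | _ n ih =>
    by_cases h : ∃ f₁ f₂ : p.tgt.E, f₁ ≠ f₂ ∧ p.IsCircuit {f₁, f₂}
    · obtain ⟨q, hq⟩ : ∃ q, Step p q := by
        obtain ⟨f₁, f₂, hne, hF⟩ := h
        -- Exchanging the two edges turns the forbidden order of multiplicities into an allowed one,
        -- so every `2`-circuit admits a step.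
        by_cases hm : p.mult f₁ = 1 ∧ p.mult f₂ = 2
        · refine ⟨_, f₂, f₁, hne.symm, by rwa [Set.pair_comm], fun h => ?_, rfl⟩
          omega
        · exact ⟨_, f₁, f₂, hne, hF, hm, rfl⟩
      obtain ⟨r, hr, hr'⟩ := ih _ (hn ▸ hq.card_lt) q rfl
      exact ⟨r, .head hq hr, hr'⟩
    · exact ⟨p, .refl, h⟩

end DoubleCover

end TropicalPrym

theorem theorem4p3 (p : TropicalPrym.DoubleCover.{u}) (hp : p.src.Connected) :
    (∃ q : TropicalPrym.DoubleCover.{u}, p.IsSimplification q) ∧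
      ∀ q : TropicalPrym.DoubleCover.{u}, p.IsSimplification q →
        Nonempty (TropicalPrym.PolarizedTorus.Iso p.prymP q.prymP) := by
  refine ⟨TropicalPrym.DoubleCover.exists_reflTransGen_step _, fun q hq => ?_⟩
  exact ((TropicalPrym.DoubleCover.isometric_contract p).trans
    (TropicalPrym.DoubleCover.isometric_of_reflTransGen hq.1
      (TropicalPrym.Graph.Connected.contract hp _)).1).nonempty_iso
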